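/- An *incidence structure* is a structure in the language $\{P,L,I\}$ ($P,L$ unary, $I$ binary) such that $P$ (the points) and $L$ (the lines) partition the domain and $I(x,y)$ (incidence) holds only for $x\in P$, $y\in L$. Let $m,n\ge 1$. An incidence structure is *$K_{m,n}$-free* if there are no $m$ distinct points and $n$ distinct lines such that each of these points is incident to each of these lines. Let $T^p_{m,n}$ be the theory of $K_{m,n}$-free incidence structures, and let $T^c_{m,n}$ be the theory of $K_{m,n}$-free incidence structures in which any $m$ distinct points simultaneously lie on exactly $n-1$ lines and any $n$ distinct lines simultaneously intersect in exactly $m-1$ points. A *safe diagram* $\Delta(\bar x;\bar y)$, where $\bar x,\bar y$ are finite tuples of variables, is the set of all atomic and negated atomic formulas true in some finite model $A$ of $T^p_{m,n}$ whose elements are bijectively labeled by $\bar x\bar y$, where in $A$ each point in $\bar y$ is incident to at most $n-1$ lines in $\bar x$ and each line in $\bar y$ is incident to at most $m-1$ points in $\bar x$. Let $\widehat\Delta(\bar x)$ be the set of those formulas in $\Delta$ which mention only variables in $\bar x$. Define $$T_{m,n}=T^c_{m,n}\cup\{\forall\bar x\,(\widehat\Delta(\bar x)\rightarrow\exists\bar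 y\,\Delta(\bar x;\bar y)) : \Delta\text{ is a safe diagram}\},$$ where a finite set of formulas is identified with its conjunction. Models of $T^p_{2,2}$ are called *partial planes*, and models of $T^c_{2,2}$ are called *projective planes* (no non-degeneracy is required). "Embeds" means: is isomorphic to an induced substructure of. A *prime model* of a theory $T$ is a model of $T$ which embeds elementarily into every model of $T$. **Theorem.** (a) Let $m,n\ge 1$. If every finite model of $T^p_{m,n}$ embeds in a finite model of $T^c_{m,n}$, then $T_{m,n}$ has a prime model. (b) $T_{2,2}$ has a prime model if and only if every finite partial plane embeds in a finite projective plane. -/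

import Mathlib

universe u

open FirstOrder

namespace Incidence

open FirstOrder.Language

/-- The relation symbols: unary predicates for points and lines, and a binary incidence relation. -/
inductive Rel : ℕ → Type
  | point : Rel 1
  | line : Rel 1
  | inc : Rel 2

/-- The relational language `{P, L, I}` of incidence structures. -/
def lang : FirstOrder.Language.{0, 0} := ⟨fun _ => Empty, Rel⟩

/-- The symbol `P` for points. -/
abbrev pointS : lang.Relations 1 := Rel.point

/-- The symbol `L` for lines. -/
abbrev lineS : lang.Relations 1 := Rel.line

/-- The symbol `I` for incidence. -/
abbrev incS : lang.Relations 2 := Rel.inc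

/-- `x` is a point of the structure `M`. -/
def IsPoint {M : Type*} [lang.Structure M] (x : M) : Prop :=
  Structure.RelMap pointS ![x]

/-- `x` is a line of the structure `M`. -/
def IsLine {M : Type*} [lang.Structure M] (x : M) : Prop :=
  Structure.RelMap lineS ![x]

/-- `x` is incident to `y` in the structure `M`. -/
def Inc {M : Type*} [lang.Structure M] (x y : M) : Prop :=
  Structure.RelMap incS ![x, y]

/-- The atomic formula `P(v)`. -/
def pointF {α : Type} (v : α) : lang.Formula α :=
  pointS.formula₁ (Term.var v)

/-- The atomic formula `L(v)`. -/
def lineF {α : Type} (v : α) : lang.Formula α :=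
  lineS.formula₁ (Term.var v)

/-- The atomic formula `I(v, w)`. -/
def incF {α : Type} (v w : α) : lang.Formula α :=
  incS.formula₂ (Term.var v) (Term.var w)

/-- The atomic formula `v = w`. -/
def eqF {α : Type} (v w : α) : lang.Formula α :=
  Term.equal (Term.var v) (Term.var w)

/-- The formula saying that the variables `f b`, for `b : β`, are pairwise distinct. -/
noncomputable def distinctF {α β : Type} [Finite β] (f : β → α) : lang.Formula α :=
  Formula.iInf fun p : {p : β × β // p.1 ≠ p.2} => (eqF (f p.1.1) (f p.1.2)).not

/-- The sentence `∀ x̄ φ(x̄)`. -/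
noncomputable def allClosure {α : Type} [Finite α] (φ : lang.Formula α) : lang.Sentence :=
  Formula.iAlls α (φ.relabel (Sum.inr : α → Empty ⊕ α))

/-- Points and lines partition the domain. -/
noncomputable def partitionAx : lang.Sentence :=
  allClosure (α := Fin 1) ((pointF 0 ⊔ lineF 0) ⊓ (pointF 0 ⊓ lineF 0).not)

/-- Incidences only hold between a point and a line, in this order. -/
noncomputable def incidenceAx : lang.Sentence :=
  allClosure (α := Fin 2) ((incF 0 1).imp (pointF 0 ⊓ lineF 1))

/-- There are no `m` distinct points and `n` distinct lines such that every one of these points is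
incident to every one of these lines. -/
noncomputable def freeAx (m n : ℕ) : lang.Sentence :=
  allClosure (α := Fin m ⊕ Fin n)
    (distinctF (Sum.inl : Fin m → _) ⊓ distinctF (Sum.inr : Fin n → _) ⊓
      Formula.iInf (fun i : Fin m => pointF (Sum.inl i)) ⊓
      Formula.iInf (fun j : Fin n => lineF (Sum.inr j)) ⊓
      Formula.iInf (fun p : Fin m × Fin n => incF (Sum.inl p.1) (Sum.inr p.2))).not

/-- The theory of `K_{m,n}`-free incidence structures. -/
noncomputable def Tp (m n : ℕ) : lang.Theory :=
  {partitionAx, incidenceAx, freeAx m n}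

/-- Any `m` distinct points simultaneously lie on exactly `n - 1` lines: there are distinct lines
`y₀, …, yₙ₋₂` incident to all of the given points, and every line incident to all of the given
points is one of them. -/
noncomputable def pointsAx (m n : ℕ) : lang.Sentence :=
  allClosure (α := Fin m)
    ((distinctF (id : Fin m → _) ⊓ Formula.iInf (fun i : Fin m => pointF i)).imp
      (Formula.iExs (Fin (n - 1))
        (distinctF (Sum.inr : Fin (n - 1) → Fin m ⊕ Fin (n - 1)) ⊓
          Formula.iInf (fun j : Fin (n - 1) => lineF (Sum.inr j)) ⊓
          Formula.iInf (fun p : Fin m × Fin (n - 1) => incF (Sum.inl p.1) (Sum.inr p.2)) ⊓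
          Formula.iAlls (Fin 1)
            ((lineF (Sum.inr 0) ⊓
                Formula.iInf (fun i : Fin m => incF (Sum.inl (Sum.inl i)) (Sum.inr 0))).imp
              (Formula.iSup (fun j : Fin (n - 1) => eqF (Sum.inr 0) (Sum.inl (Sum.inr j))))))))

/-- Any `n` distinct lines intersect in exactly `m - 1` points. -/
noncomputable def linesAx (m n : ℕ) : lang.Sentence :=
  allClosure (α := Fin n)
    ((distinctF (id : Fin n → _) ⊓ Formula.iInf (fun j : Fin n => lineF j)).imp
      (Formula.iExs (Fin (m - 1))
        (distinctF (Sum.inr : Fin (m - 1) → Fin n ⊕ Fin (m - 1)) ⊓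
          Formula.iInf (fun i : Fin (m - 1) => pointF (Sum.inr i)) ⊓
          Formula.iInf (fun p : Fin (m - 1) × Fin n => incF (Sum.inr p.1) (Sum.inl p.2)) ⊓
          Formula.iAlls (Fin 1)
            ((pointF (Sum.inr 0) ⊓
                Formula.iInf (fun j : Fin n => incF (Sum.inr 0) (Sum.inl (Sum.inl j)))).imp
              (Formula.iSup (fun i : Fin (m - 1) => eqF (Sum.inr 0) (Sum.inl (Sum.inr i))))))))

/-- The theory of `K_{m,n}`-free incidence structures in which any `m` points simultaneously lie on
exactly `n - 1` lines and any `n` lines intersect in exactly `m - 1` points. -/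
noncomputable def Tc (m n : ℕ) : lang.Theory :=
  Tp m n ∪ {pointsAx m n, linesAx m n}

open Classical in
/-- The formula `φ` if `p` is true, and its negation otherwise. -/
noncomputable def literal {α : Type} (p : Prop) (φ : lang.Formula α) : lang.Formula α :=
  if p then φ else φ.not

/-- The diagram of a tuple `f : β → A` of elements of a structure `A`: the conjunction of all atomic
and negated atomic formulas in variables `b : β` which hold in `A` when `b` is interpreted as
`f b`. -/
noncomputable def diagram {A β : Type} [lang.Structure A] [Finite β] (f : β → A) :
    lang.Formula β :=
  Formula.iInf (fun b : β => literal (IsPoint (f b)) (pointF b)) ⊓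
    Formula.iInf (fun b : β => literal (IsLine (f b)) (lineF b)) ⊓
    Formula.iInf (fun p : β × β => literal (Inc (f p.1) (f p.2)) (incF p.1 p.2)) ⊓
    Formula.iInf (fun p : β × β => literal (f p.1 = f p.2) (eqF p.1 p.2))

/-- A structure with elements labelled by `x₀, …, xₖ₋₁, y₀, …, yₗ₋₁` has a safe diagram if it is a
`K_{m,n}`-free incidence structure, every point among the `yᵢ` is incident to at most `n - 1` lines
among the `xⱼ`, and every line among the `yᵢ` is incident to at most `m - 1` points among the
`xⱼ`. -/
structure IsSafe (m n : ℕ) {k l : ℕ} (A : lang.Structure (Fin k ⊕ Fin l)) : Prop where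
  free : (Fin k ⊕ Fin l) ⊨ Tp m n
  points : ∀ i : Fin l, IsPoint (Sum.inr i : Fin k ⊕ Fin l) →
    {j : Fin k | IsLine (Sum.inl j : Fin k ⊕ Fin l) ∧
      Inc (Sum.inr i : Fin k ⊕ Fin l) (Sum.inl j)}.ncard ≤ n - 1
  lines : ∀ i : Fin l, IsLine (Sum.inr i : Fin k ⊕ Fin l) →
    {j : Fin k | IsPoint (Sum.inl j : Fin k ⊕ Fin l) ∧
      Inc (Sum.inl j : Fin k ⊕ Fin l) (Sum.inr i)}.ncard ≤ m - 1

/-- The sentence `∀ x̄ (Δ₀(x̄) → ∃ ȳ Δ(x̄, ȳ))`, where `Δ` is the diagram of `A` and `Δ₀` is the part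
of `Δ` which mentions only the variables `x̄`. -/
noncomputable def extensionAx {k l : ℕ} (A : lang.Structure (Fin k ⊕ Fin l)) : lang.Sentence :=
  allClosure (α := Fin k)
    ((diagram (Sum.inl : Fin k → Fin k ⊕ Fin l)).imp
      (Formula.iExs (Fin l) (diagram (id : Fin k ⊕ Fin l → Fin k ⊕ Fin l))))

/-- The theory `T_{m,n}` of existentially closed `K_{m,n}`-free incidence structures. -/
noncomputable def T (m n : ℕ) : lang.Theory :=
  Tc m n ∪ {σ | ∃ (k l : ℕ) (A : lang.Structure (Fin k ⊕ Fin l)), IsSafe m n A ∧ σ = extensionAx A}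

/-- `T` has a prime model: a model which embeds elementarily into every model of `T` (in an
arbitrary universe `u`). As the language is countable, it is no loss to look for the prime model in
`Type`. -/
def HasPrimeModel (T : lang.Theory) : Prop :=
  ∃ M : Theory.ModelType.{0, 0, 0} T, ∀ N : Theory.ModelType.{0, 0, u} T, Nonempty (M ↪ₑ[lang] N)

end Incidence

/-! The axioms of `T m n` let a partial embedding be extended to finitely many new elements as soon
as these are safe over its domain. Safety is automatic over a substructure that satisfies the axioms
of `Tc m n`: if an outside point lay on n of its lines, that point and the m - 1 points in which
these lines already meet would give a K_{m,n} (`Geo.IsEmb.not_forall_inc`, `exists_extension`).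
Hence `T m n` is model complete (`realize_comp_iff`): if M is a submodel of N, every finite part of
N can be copied into M over M, so N embeds over M into an ultrapower of M, and induction on formulas
together with Łoś's theorem gives M ≼ N.

Models with domain ℕ come from a generic construction. Conditions are finite K_{m,n}-free structures
on sets of natural numbers, and a filter meeting suitable countably many cofinal sets yields a model
of `T m n` (`Cond.exists_generic`). Free amalgamation provides the cofinal sets for the extension
axioms.

For (a), if finite structures have finite completions, the generic model can be made a union of
finite complete pieces. By the extension property it embeds piece by piece into any model of `T m
n`, and by model completeness the embedding is elementary.

For (b), suppose that a finite partial plane A lies in no finite projective plane, while M is a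
prime model. Fix in M a copy of A and seven points in general position with their joining lines;
call this tuple a. It suffices that, for each tuple a' of naturals, the conditions excluding an
embedding of M with a ↦ a' are cofinal (`Cond.exists_no_wit`): a generic model then admits no
embedding of M.

Suppose instead that every extension of some condition C remains compatible with such an embedding.
Call an element of C tracked if it is the image of one fixed element of M under all compatible
embeddings. A point or line determined by tracked elements is tracked. If two tracked lines did not
meet, or two tracked points were not joined, free constructions would give three tracked points,
pairwise not joined, that could be made collinear or not at will, although M has already decided
this (`Cond.exists_no_wit_of_not_joined`). So the tracked elements of C form a finite projective
plane containing A, a contradiction. -/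

namespace Incidence

open FirstOrder.Language

/-! ### Semantics of the formulas and axioms -/

section Realize

variable {α : Type} {M : Type*} [lang.Structure M] {v : α → M}

@[simp] lemma realize_pointF {a : α} : (pointF a).Realize v ↔ IsPoint (v a) :=
  Formula.realize_rel₁

@[simp] lemma realize_lineF {a : α} : (lineF a).Realize v ↔ IsLine (v a) :=
  Formula.realize_rel₁

@[simp] lemma realize_incF {a b : α} : (incF a b).Realize v ↔ Inc (v a) (v b) :=
  Formula.realize_rel₂

@[simp] lemma realize_eqF {a b : α} : (eqF a b).Realize v ↔ v a = v b :=
  Formula.realize_equal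

@[simp] lemma realize_distinctF {β : Type} [Finite β] {f : β → α} :
    (distinctF f).Realize v ↔ Function.Injective (v ∘ f) := by
  simp only [distinctF, Formula.realize_iInf, Formula.realize_not, realize_eqF, Subtype.forall,
    Prod.forall, Function.Injective, Function.comp_apply]
  exact forall₂_congr fun a b => not_imp_not

@[simp] lemma realize_allClosure [Finite α] {φ : lang.Formula α} :
    M ⊨ allClosure φ ↔ ∀ w : α → M, φ.Realize w := by
  simp only [allClosure, Sentence.Realize, Formula.realize_iAlls, Formula.realize_relabel]
  rfl

@[simp] lemma realize_literal {p : Prop} {φ : lang.Formula α} :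
    (literal p φ).Realize v ↔ (φ.Realize v ↔ p) := by
  unfold literal
  split_ifs with h <;> simp [h]

lemma realize_diagram {A β : Type} [lang.Structure A] [Finite β] {f : β → A} {w : β → M} :
    (diagram f).Realize w ↔ (∀ b, IsPoint (w b) ↔ IsPoint (f b)) ∧
      (∀ b, IsLine (w b) ↔ IsLine (f b)) ∧ (∀ b c, Inc (w b) (w c) ↔ Inc (f b) (f c)) ∧
      ∀ b c, w b = w c ↔ f b = f c := by
  simp [diagram, and_assoc]

lemma realize_extensionAx {k l : ℕ} {A : lang.Structure (Fin k ⊕ Fin l)} :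
    M ⊨ extensionAx A ↔ ∀ x : Fin k → M,
      (diagram (Sum.inl : Fin k → Fin k ⊕ Fin l)).Realize x →
      ∃ y : Fin l → M, (diagram (id : Fin k ⊕ Fin l → Fin k ⊕ Fin l)).Realize (Sum.elim x y) := by
  simp [extensionAx]

end Realize

/-! ### Incidence structures as combinatorial objects, and their translation to first-order
structures -/

/-- An incidence structure on `α`, in which the elements that are not points are the lines. -/
@[ext] structure Geo (α : Type*) where
  pt : α → Prop
  inc : α → α → Prop
  pt_of_inc : ∀ {x y}, inc x y → pt x
  not_pt_of_inc : ∀ {x y}, inc x y → ¬ pt y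

namespace Geo

variable {α β γ : Type*}

/-- The dual incidence structure, with points and lines exchanged. -/
def dual (G : Geo α) : Geo α where
  pt x := ¬ G.pt x
  inc x y := G.inc y x
  pt_of_inc h := G.not_pt_of_inc h
  not_pt_of_inc h := not_not.2 (G.pt_of_inc h)

@[simp] lemma dual_dual (G : Geo α) : G.dual.dual = G := by
  ext <;> simp [dual]

/-- `G` is `K_{m,n}`-free. -/
def Free (m n : ℕ) (G : Geo α) : Prop :=
  ∀ P L : Finset α, P.card = m → L.card = n → ¬ ∀ p ∈ P, ∀ l ∈ L, G.inc p l

/-- Any `m` points of `G` lie on `n - 1` common lines. -/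
def Joins (m n : ℕ) (G : Geo α) : Prop :=
  ∀ P : Finset α, P.card = m → (∀ p ∈ P, G.pt p) →
    ∃ L : Finset α, L.card = n - 1 ∧ (∀ l ∈ L, ¬ G.pt l) ∧ ∀ p ∈ P, ∀ l ∈ L, G.inc p l

/-- Any `m` points of `G` lie on `n - 1` common lines, and any `n` lines of `G` meet in `m - 1`
common points. -/
def Complete (m n : ℕ) (G : Geo α) : Prop :=
  G.Joins m n ∧ G.dual.Joins n m

lemma Free.dual {m n : ℕ} {G : Geo α} (h : G.Free m n) : G.dual.Free n m :=
  fun P L hP hL H => h L P hL hP fun p hp l hl => H l hl p hp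

lemma Complete.dual {m n : ℕ} {G : Geo α} (h : G.Complete m n) : G.dual.Complete n m :=
  ⟨h.2, by rw [dual_dual]; exact h.1⟩

/-- `f` is an embedding of the incidence structure `G` into `H`. -/
structure IsEmb (G : Geo α) (H : Geo β) (f : α → β) : Prop where
  inj : Function.Injective f
  pt : ∀ x, H.pt (f x) ↔ G.pt x
  inc : ∀ x y, H.inc (f x) (f y) ↔ G.inc x y

/-- The incidence structure pulled back along a map. -/
def comap (f : α → β) (H : Geo β) : Geo α where
  pt x := H.pt (f x)
  inc x y := H.inc (f x) (f y)
  pt_of_inc h := H.pt_of_inc h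
  not_pt_of_inc h := H.not_pt_of_inc h

lemma isEmb_comap {f : α → β} (hf : Function.Injective f) (H : Geo β) : IsEmb (H.comap f) H f :=
  ⟨hf, fun _ => Iff.rfl, fun _ _ => Iff.rfl⟩

lemma IsEmb.comp {G : Geo α} {H : Geo β} {K : Geo γ} {f : α → β} {g : β → γ}
    (hg : IsEmb H K g) (hf : IsEmb G H f) : IsEmb G K (g ∘ f) :=
  ⟨hg.inj.comp hf.inj, fun x => (hg.pt _).trans (hf.pt x),
    fun x y => (hg.inc _ _).trans (hf.inc x y)⟩

lemma IsEmb.dual {G : Geo α} {H : Geo β} {f : α → β} (hf : IsEmb G H f) :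
    IsEmb G.dual H.dual f :=
  ⟨hf.inj, fun x => not_congr (hf.pt x), fun x y => hf.inc y x⟩

lemma IsEmb.free {m n : ℕ} {G : Geo α} {H : Geo β} {f : α → β} (hf : IsEmb G H f)
    (h : H.Free m n) : G.Free m n := by
  intro P L hP hL H'
  refine h (P.map ⟨f, hf.inj⟩) (L.map ⟨f, hf.inj⟩) (by simpa) (by simpa) ?_
  simpa [hf.inc] using H'

/-- The structure in the language of incidence structures given by `G`. -/
@[reducible] def toStructure (G : Geo α) : lang.Structure α where
  funMap f := f.elim
  RelMap := fun {_} r => match r with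
    | .point => fun x => G.pt (x 0)
    | .line => fun x => ¬ G.pt (x 0)
    | .inc => fun x => G.inc (x 0) (x 1)

end Geo

/-- The axioms of incidence structures, stated semantically. -/
structure IsGeo (M : Type*) [lang.Structure M] : Prop where
  line_iff : ∀ x : M, IsLine x ↔ ¬ IsPoint x
  inc : ∀ x y : M, Inc x y → IsPoint x ∧ IsLine y

/-- The incidence structure underlying a first-order structure. -/
def geo (M : Type*) [lang.Structure M] : Geo M where
  pt x := IsPoint x
  inc x y := Inc x y ∧ IsPoint x ∧ ¬ IsPoint y
  pt_of_inc h := h.2.1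
  not_pt_of_inc h := h.2.2

/-- The type conditions built into `geo` only serve to make it defined on every structure; the
incidence axiom makes them redundant. -/
lemma IsGeo.geo_inc {M : Type*} [lang.Structure M] (h : IsGeo M) {x y : M} :
    (geo M).inc x y ↔ Inc x y :=
  ⟨And.left, fun H => ⟨H, (h.inc x y H).1, (h.line_iff y).1 (h.inc x y H).2⟩⟩

lemma geo_pt {M : Type*} [lang.Structure M] {x : M} : (geo M).pt x ↔ IsPoint x := Iff.rfl

lemma Geo.isGeo {α : Type*} (G : Geo α) : letI := G.toStructure; IsGeo α :=
  let _ := G.toStructure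
  ⟨fun _ => Iff.rfl, fun _ _ h => ⟨G.pt_of_inc h, G.not_pt_of_inc h⟩⟩

lemma Geo.geo_toStructure {α : Type*} (G : Geo α) : letI := G.toStructure; geo α = G := by
  let _ := G.toStructure
  ext x y
  · rfl
  · exact G.isGeo.geo_inc

/-- `Geo.Free` does not ask that its two sets consist of points and of lines. Since m and n are
positive, every member of either set takes part in an incidence, and this fixes its type. -/
lemma model_Tp {m n : ℕ} (hm : 1 ≤ m) (hn : 1 ≤ n) {M : Type*} [lang.Structure M] :
    M ⊨ Tp m n ↔ IsGeo M ∧ (geo M).Free m n := by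
  have key : IsGeo M → (M ⊨ freeAx m n ↔ (geo M).Free m n) := by
    intro h
    simp only [freeAx, realize_allClosure, Formula.realize_not, Formula.realize_inf,
      realize_distinctF, Formula.realize_iInf, realize_pointF, realize_lineF, realize_incF]
    constructor
    · intro H P L hP hL hI
      let eP := P.equivFinOfCardEq hP
      let eL := L.equivFinOfCardEq hL
      refine H (Sum.elim (fun i => eP.symm i) (fun i => eL.symm i)) ⟨⟨⟨⟨?_, ?_⟩, ?_⟩, ?_⟩, ?_⟩
      · exact Subtype.val_injective.comp eP.symm.injective
      · exact Subtype.val_injective.comp eL.symm.injective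
      · intro i
        exact (geo M).pt_of_inc (hI _ (eP.symm i).2 _ (eL.symm ⟨0, hn⟩).2)
      · intro i
        exact (h.line_iff _).2 ((geo M).not_pt_of_inc (hI _ (eP.symm ⟨0, hm⟩).2 _ (eL.symm i).2))
      · rintro ⟨i, j⟩
        exact h.geo_inc.1 (hI _ (eP.symm i).2 _ (eL.symm j).2)
    · rintro H w ⟨⟨⟨⟨h1, h2⟩, -⟩, -⟩, h5⟩
      refine H (Finset.univ.map ⟨_, h1⟩) (Finset.univ.map ⟨_, h2⟩) (by simp) (by simp) ?_
      simp only [Finset.mem_map, Finset.mem_univ, true_and, forall_exists_index,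
        forall_apply_eq_imp_iff, Function.Embedding.coeFn_mk, Function.comp_apply, h.geo_inc]
      exact fun i j => h5 (i, j)
  have key2 : (M ⊨ partitionAx ∧ M ⊨ incidenceAx) ↔ IsGeo M := by
    simp only [partitionAx, incidenceAx, realize_allClosure, Formula.realize_not,
      Formula.realize_inf, Formula.realize_sup, Formula.realize_imp, realize_pointF, realize_lineF,
      realize_incF]
    constructor
    · rintro ⟨h1, h2⟩
      exact ⟨fun x => by have := h1 ![x]; simp at this; tauto,
        fun x y => by simpa using h2 ![x, y]⟩
    · rintro ⟨h1, h2⟩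
      exact ⟨fun w => by have := h1 (w 0); tauto, fun w => h2 _ _⟩
  simp only [Tp, Theory.model_iff, Set.mem_insert_iff, Set.mem_singleton_iff, forall_eq_or_imp,
    forall_eq, ← and_assoc]
  rw [key2]
  exact and_congr_right key

/-- Freeness already bounds the number of common lines by n - 1, so "exactly n - 1" in the axioms
amounts to the bare existence asked by `Joins`. -/
lemma Geo.Free.joins_iff {m n : ℕ} (hn : 1 ≤ n) {α : Type*} {G : Geo α}
    (hF : G.Free m n) :
    G.Joins m n ↔ ∀ w : Fin m → α, Function.Injective w → (∀ i, G.pt (w i)) →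
      ∃ l : Fin (n - 1) → α, Function.Injective l ∧ (∀ j, ¬ G.pt (l j)) ∧
        (∀ i j, G.inc (w i) (l j)) ∧ ∀ y, (∀ i, G.inc (w i) y) → ∃ j, y = l j := by
  classical
  constructor
  · intro H w hw hpt
    obtain ⟨L, hL, hLpt, hinc⟩ := H (Finset.univ.map ⟨w, hw⟩) (by simp) (by simpa using hpt)
    let e := L.equivFinOfCardEq hL
    refine ⟨fun j => e.symm j, Subtype.val_injective.comp e.symm.injective,
      fun j => hLpt _ (e.symm j).2, fun i j => hinc _ (by simp) _ (e.symm j).2, ?_⟩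
    intro y hy
    by_cases hyL : y ∈ L
    · exact ⟨e ⟨y, hyL⟩, by simp⟩
    · refine absurd ?_ (hF (Finset.univ.map ⟨w, hw⟩) (insert y L) (by simp)
        (by rw [Finset.card_insert_of_notMem hyL]; omega))
      intro p hp l hl
      rcases Finset.mem_insert.1 hl with rfl | hl
      · obtain ⟨i, -, rfl⟩ := Finset.mem_map.1 hp
        exact hy i
      · exact hinc p hp l hl
  · intro H P hP hpt
    let e := P.equivFinOfCardEq hP
    obtain ⟨l, hl, hl', hinc, -⟩ := H (fun i => e.symm i)
      (Subtype.val_injective.comp e.symm.injective) (fun i => hpt _ (e.symm i).2)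
    refine ⟨Finset.univ.map ⟨l, hl⟩, by simp, by simpa using hl', ?_⟩
    intro p hp x hx
    obtain ⟨j, -, rfl⟩ := Finset.mem_map.1 hx
    simpa using hinc (e ⟨p, hp⟩) j

lemma model_Tc {m n : ℕ} (hm : 1 ≤ m) (hn : 1 ≤ n) {M : Type*} [lang.Structure M] :
    M ⊨ Tc m n ↔ IsGeo M ∧ (geo M).Free m n ∧ (geo M).Complete m n := by
  have key : IsGeo M → (geo M).Free m n → ((M ⊨ pointsAx m n ∧ M ⊨ linesAx m n) ↔
      (geo M).Complete m n) := by
    intro h hF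
    rw [Geo.Complete, hF.joins_iff hn, hF.dual.joins_iff hm]
    refine and_congr ?_ ?_
    · simp only [pointsAx, realize_allClosure, Formula.realize_imp, Formula.realize_inf,
        realize_distinctF, Formula.realize_iInf, realize_pointF, realize_lineF, realize_incF,
        Formula.realize_iExs, Formula.realize_iAlls, Formula.realize_iSup, realize_eqF]
      refine forall_congr' fun w => ?_
      rw [and_imp]
      refine imp_congr Iff.rfl (imp_congr Iff.rfl (exists_congr fun l => ?_))
      simp only [and_assoc]
      refine and_congr Iff.rfl (and_congr (forall_congr' fun j => h.line_iff _) (and_congr ?_ ?_))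
      · simp [h.geo_inc]
      · rw [← (Equiv.funUnique (Fin 1) M).symm.forall_congr_right]
        refine forall_congr' fun y => ?_
        simp only [Sum.elim_inl, Sum.elim_inr, h.geo_inc]
        exact ⟨fun H hy => H ⟨(h.inc _ _ (hy ⟨0, hm⟩)).2, hy⟩, fun H hy => H hy.2⟩
    · simp only [linesAx, realize_allClosure, Formula.realize_imp, Formula.realize_inf,
        realize_distinctF, Formula.realize_iInf, realize_pointF, realize_lineF, realize_incF,
        Formula.realize_iExs, Formula.realize_iAlls, Formula.realize_iSup, realize_eqF]
      refine forall_congr' fun w => ?_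
      rw [and_imp]
      refine imp_congr Iff.rfl (imp_congr (forall_congr' fun j => h.line_iff _)
        (exists_congr fun l => ?_))
      simp only [and_assoc]
      refine and_congr Iff.rfl (and_congr (forall_congr' fun j => not_not.symm) (and_congr ?_ ?_))
      · simp only [Geo.dual, Prod.forall, h.geo_inc]
        exact forall_comm
      · rw [← (Equiv.funUnique (Fin 1) M).symm.forall_congr_right]
        refine forall_congr' fun y => ?_
        simp only [Sum.elim_inl, Sum.elim_inr, Geo.dual, h.geo_inc]
        exact ⟨fun H hy => H ⟨(h.inc _ _ (hy ⟨0, hn⟩)).1, hy⟩, fun H hy => H hy.2⟩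
  rw [Tc, Theory.model_union_iff, model_Tp hm hn, and_assoc]
  simp only [Theory.model_iff, Set.mem_insert_iff, Set.mem_singleton_iff, forall_eq_or_imp,
    forall_eq]
  exact and_congr_right fun h => and_congr_right fun hF => key h hF

/-- Embeddings of incidence structures as first-order embeddings. -/
def Geo.IsEmb.toEmbedding {M N : Type*} [lang.Structure M] [lang.Structure N] {f : M → N}
    (hM : IsGeo M) (hN : IsGeo N) (hf : Geo.IsEmb (geo M) (geo N) f) : M ↪[lang] N where
  toFun := f
  inj' := hf.inj
  map_fun' g := g.elim
  map_rel' := by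
    have hpt : ∀ x, IsPoint (f x) ↔ IsPoint x := hf.pt
    have hinc : ∀ x y, Inc (f x) (f y) ↔ Inc x y := fun x y => by
      rw [← hN.geo_inc, ← hM.geo_inc]; exact hf.inc x y
    intro k r x
    cases r with
    | point =>
      have h1 : x = ![x 0] := by ext i; fin_cases i; rfl
      have h2 : f ∘ x = ![f (x 0)] := by ext i; fin_cases i; rfl
      rw [h2]; conv_rhs => rw [h1]
      exact hpt (x 0)
    | line =>
      have h1 : x = ![x 0] := by ext i; fin_cases i; rfl
      have h2 : f ∘ x = ![f (x 0)] := by ext i; fin_cases i; rfl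
      rw [h2]; conv_rhs => rw [h1]
      exact (hN.line_iff (f (x 0))).trans ((not_congr (hpt _)).trans (hM.line_iff (x 0)).symm)
    | inc =>
      have h1 : x = ![x 0, x 1] := by ext i; fin_cases i <;> rfl
      have h2 : f ∘ x = ![f (x 0), f (x 1)] := by ext i; fin_cases i <;> rfl
      rw [h2]; conv_rhs => rw [h1]
      exact hinc (x 0) (x 1)

lemma map_isPoint {M N : Type*} [lang.Structure M] [lang.Structure N] (f : M ↪[lang] N) (x : M) :
    IsPoint (f x) ↔ IsPoint x := by
  have := f.map_rel pointS ![x]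
  rwa [show f ∘ ![x] = ![f x] by ext i; fin_cases i; rfl] at this

lemma map_inc {M N : Type*} [lang.Structure M] [lang.Structure N] (f : M ↪[lang] N) (x y : M) :
    Inc (f x) (f y) ↔ Inc x y := by
  have := f.map_rel incS ![x, y]
  rwa [show f ∘ ![x, y] = ![f x, f y] by ext i; fin_cases i <;> rfl] at this

lemma isEmb_embedding {M N : Type*} [lang.Structure M] [lang.Structure N] (f : M ↪[lang] N) :
    Geo.IsEmb (geo M) (geo N) f :=
  ⟨f.injective, map_isPoint f, fun x y => by simp only [geo, map_isPoint, map_inc]⟩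

lemma model_Tc_of_model_T {m n : ℕ} {M : Type*} [lang.Structure M] (h : M ⊨ T m n) :
    M ⊨ Tc m n :=
  (Theory.model_union_iff.1 h).1

/-! ### Extension of embeddings into models of `T` -/

/-- An element outside of an embedded complete substructure is incident to fewer than `n` of its
lines. -/
lemma Geo.IsEmb.not_forall_inc {m n : ℕ} (hm : 1 ≤ m) {α γ : Type*} {G : Geo α} {K : Geo γ}
    {f : α → γ} (hf : IsEmb G K f) (hG : G.Complete m n) (hK : K.Free m n) {b : γ}
    (hb : b ∉ Set.range f) (L : Finset γ) (hL : (L : Set γ) ⊆ Set.range f) (hn : L.card = n) :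
    ¬ ∀ l ∈ L, K.inc b l := by
  classical
  intro H
  obtain ⟨L', rfl⟩ : ∃ L' : Finset α, L'.map ⟨f, hf.inj⟩ = L := by
    refine ⟨L.preimage f hf.inj.injOn, ?_⟩
    ext y
    simp only [Finset.mem_map, Finset.mem_preimage, Function.Embedding.coeFn_mk]
    refine ⟨by rintro ⟨a, ha, rfl⟩; exact ha, fun hy => ?_⟩
    obtain ⟨a, rfl⟩ := hL hy
    exact ⟨a, hy, rfl⟩
  rw [Finset.card_map] at hn
  replace H : ∀ l ∈ L', K.inc b (f l) := fun l hl => H _ (Finset.mem_map_of_mem _ hl)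
  -- The n lines already meet in m - 1 points of `G`; the outside element `b` would be an m-th one.
  obtain ⟨P, hP, -, hinc⟩ := hG.2 L' hn fun l hl => by
    have := K.not_pt_of_inc (H l hl)
    rwa [hf.pt] at this
  have hbP : b ∉ P.map ⟨f, hf.inj⟩ := by
    intro h
    obtain ⟨a, -, rfl⟩ := Finset.mem_map.1 h
    exact hb ⟨a, rfl⟩
  refine hK (insert b (P.map ⟨f, hf.inj⟩)) (L'.map ⟨f, hf.inj⟩)
    (by rw [Finset.card_insert_of_notMem hbP, Finset.card_map]; omega) (by simpa) ?_
  intro p hp l' hl'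
  obtain ⟨l, hl, rfl : f l = _⟩ := Finset.mem_map.1 hl'
  rcases Finset.mem_insert.1 hp with rfl | hp
  · exact H l hl
  · obtain ⟨q, hq, rfl : f q = _⟩ := Finset.mem_map.1 hp
    exact (hf.inc _ _).2 (hinc l hl q hq)

/-- The extension axioms, in terms of incidence structures on arbitrary finite types. -/
lemma exists_extension_of_safe {m n : ℕ} (hm : 1 ≤ m) (hn : 1 ≤ n) {M : Type*} [lang.Structure M]
    (hT : M ⊨ T m n) {β : Type*} [Finite β] {H : Geo β} (hH : H.Free m n) (s : Set β) (x : β → M)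
    (hinj : Set.InjOn x s) (hpt : ∀ b ∈ s, (geo M).pt (x b) ↔ H.pt b)
    (hinc : ∀ b ∈ s, ∀ c ∈ s, (geo M).inc (x b) (x c) ↔ H.inc b c)
    (hpoints : ∀ b ∉ s, ∀ L : Finset β, (L : Set β) ⊆ s → L.card = n → ¬ ∀ l ∈ L, H.inc b l)
    (hlines : ∀ b ∉ s, ∀ L : Finset β, (L : Set β) ⊆ s → L.card = m → ¬ ∀ l ∈ L, H.inc l b) :
    ∃ f : β → M, Set.EqOn f x s ∧ Geo.IsEmb H (geo M) f := by
  classical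
  have hM := ((model_Tc hm hn).1 (model_Tc_of_model_T hT)).1
  obtain ⟨k, ⟨ek⟩⟩ := Finite.exists_equiv_fin s
  obtain ⟨l, ⟨el⟩⟩ := Finite.exists_equiv_fin (sᶜ : Set β)
  -- The variables x̄ label `s` and the variables ȳ label its complement.
  let e : Fin k ⊕ Fin l ≃ β := (ek.symm.sumCongr el.symm).trans (Equiv.Set.sumCompl s)
  have el1 : ∀ i, e (Sum.inl i) = ek.symm i := fun i => by simp [e]
  have er1 : ∀ i, e (Sum.inr i) = el.symm i := fun i => by simp [e]
  have hls : ∀ i, e (Sum.inl i) ∈ s := fun i => by rw [el1]; exact (ek.symm i).2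
  have hrs : ∀ i, e (Sum.inr i) ∉ s := fun i => by rw [er1]; exact (el.symm i).2
  let A := (H.comap e).toStructure
  have hg : geo (Fin k ⊕ Fin l) = H.comap e := (H.comap e).geo_toStructure
  have hA : IsGeo (Fin k ⊕ Fin l) := (H.comap e).isGeo
  have card_le : ∀ (r : ℕ) (q : Fin k → Prop), 1 ≤ r →
      (∀ L : Finset β, (L : Set β) ⊆ s → L.card = r → ¬ ∀ l ∈ L, ∃ j, q j ∧ e (Sum.inl j) = l) →
      {j | q j}.ncard ≤ r - 1 := by
    intro r q hr hL
    by_contra hlt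
    obtain ⟨t, ht, htc⟩ := Set.exists_subset_card_eq (s := {j | q j}) (n := r) (by omega)
    have htf := t.toFinite
    refine hL (htf.toFinset.map ⟨fun j => e (Sum.inl j), e.injective.comp Sum.inl_injective⟩)
      ?_ ?_ ?_
    · intro y hy
      simp only [Finset.coe_map, Function.Embedding.coeFn_mk, Set.mem_image] at hy
      obtain ⟨j, -, rfl⟩ := hy
      exact hls j
    · rw [Finset.card_map, ← htc, Set.ncard_eq_toFinset_card t htf]
    · intro y hy
      simp only [Finset.mem_map, Set.Finite.mem_toFinset, Function.Embedding.coeFn_mk] at hy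
      obtain ⟨j, hj, rfl⟩ := hy
      exact ⟨j, ht hj, rfl⟩
  have hsafe : IsSafe m n A := by
    refine ⟨?_, fun i hi => ?_, fun i hi => ?_⟩
    · rw [model_Tp hm hn, hg]
      exact ⟨hA, (Geo.isEmb_comap e.injective H).free hH⟩
    · refine card_le n _ hn fun L hL hc hq => hpoints _ (hrs i) L hL hc fun l hl => ?_
      obtain ⟨j, ⟨-, hj⟩, rfl⟩ := hq l hl
      exact hj
    · refine card_le m _ hm fun L hL hc hq => hlines _ (hrs i) L hL hc fun l hl => ?_
      obtain ⟨j, ⟨-, hj⟩, rfl⟩ := hq l hl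
      exact hj
  have hax : M ⊨ extensionAx A :=
    Theory.model_iff _ |>.1 (Theory.model_union_iff.1 hT).2 _ ⟨k, l, A, hsafe, rfl⟩
  rw [realize_extensionAx] at hax
  have hAinc : ∀ b c : Fin k ⊕ Fin l, Inc b c ↔ H.inc (e b) (e c) := fun b c => Iff.rfl
  have hApt : ∀ b : Fin k ⊕ Fin l, IsPoint b ↔ H.pt (e b) := fun b => Iff.rfl
  obtain ⟨y, hy⟩ := hax (fun i => x (e (Sum.inl i))) <| realize_diagram.2 <| by
    refine ⟨fun b => hpt _ (hls b), fun b => ?_, fun b c => ?_, fun b c => ?_⟩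
    · rw [hM.line_iff, hA.line_iff]
      exact not_congr (hpt _ (hls b))
    · rw [← hM.geo_inc, hinc _ (hls b) _ (hls c)]
      exact (hAinc _ _).symm
    · rw [hinj.eq_iff (hls b) (hls c), e.injective.eq_iff]
  obtain ⟨h1, -, h3, h4⟩ := realize_diagram.1 hy
  refine ⟨Sum.elim (fun i => x (e (Sum.inl i))) y ∘ e.symm, ?_, ?_, ?_, ?_⟩
  · intro b hb
    obtain ⟨c, rfl⟩ := e.surjective b
    rcases c with c | c
    · simp
    · exact absurd hb (hrs c)
  · refine Function.Injective.comp ?_ e.symm.injective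
    exact fun b c h => (h4 b c).1 h
  · intro b
    exact (h1 _).trans (by rw [hApt]; simp)
  · intro b c
    rw [hM.geo_inc]
    exact (h3 _ _).trans (by rw [hAinc]; simp)

/-- An embedding of a complete incidence structure `G` into a model of `T` extends to any finite
part of a `K_{m,n}`-free incidence structure containing `G`. -/
lemma exists_extension {m n : ℕ} (hm : 1 ≤ m) (hn : 1 ≤ n) {M : Type*} [lang.Structure M]
    [Nonempty M] (hT : M ⊨ T m n) {α γ : Type*} {G : Geo α} {K : Geo γ} {f : α → γ}
    (hf : Geo.IsEmb G K f) (hG : G.Complete m n) (hK : K.Free m n) {x : α → M}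
    (hx : Geo.IsEmb G (geo M) x) (S : Finset γ) :
    ∃ h : γ → M, h ∘ f = x ∧ Set.InjOn h S ∧ (∀ b ∈ S, (geo M).pt (h b) ↔ K.pt b) ∧
      ∀ b ∈ S, ∀ c ∈ S, (geo M).inc (h b) (h c) ↔ K.inc b c := by
  classical
  -- Values off the range of `f` are junk: only those on `S ∩ range f` serve as the parameters x̄,
  -- and elements of `S` outside the range are reassigned below.
  let x' : γ → M := Function.extend f x fun _ => Classical.arbitrary M
  have hx' : ∀ a, x' (f a) = x a := fun a => hf.inj.extend_apply _ _ _
  have hSf := Geo.isEmb_comap (H := K) (Subtype.val_injective (p := (· ∈ S)))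
  have hset : ∀ L : Finset S, (L : Set S) ⊆ {b : S | (b : γ) ∈ Set.range f} →
      ((L.map (Function.Embedding.subtype _) : Finset γ) : Set γ) ⊆ Set.range f := by
    intro L hL y hy
    simp only [Finset.coe_map, Set.mem_image, Finset.mem_coe] at hy
    obtain ⟨b, hb, rfl⟩ := hy
    exact hL hb
  obtain ⟨g, hg, hgE⟩ := exists_extension_of_safe hm hn hT (hSf.free hK)
    {b : S | (b : γ) ∈ Set.range f} (fun b => x' b) (by
      rintro ⟨_, h₁⟩ ⟨a, rfl⟩ ⟨_, h₂⟩ ⟨b, rfl⟩ hab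
      have : a = b := hx.inj (by simpa only [hx'] using hab)
      exact Subtype.ext (congrArg f this)) (by
      rintro ⟨-, -⟩ ⟨a, rfl⟩
      simp only [hx', Geo.comap]
      rw [hx.pt, hf.pt]) (by
      rintro ⟨-, -⟩ ⟨a, rfl⟩ ⟨-, -⟩ ⟨b, rfl⟩
      simp only [hx', Geo.comap]
      rw [hx.inc, hf.inc])
    (fun b hb L hL hc H => hf.not_forall_inc hm hG hK hb (L.map (Function.Embedding.subtype _))
      (hset L hL) (by simpa) (by simpa [Geo.comap] using H))
    (fun b hb L hL hc H => hf.dual.not_forall_inc hn hG.dual hK.dual hb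
      (L.map (Function.Embedding.subtype _)) (hset L hL) (by simpa)
      (by simpa [Geo.comap, Geo.dual] using H))
  have hSh : ∀ (b : γ) (hb : b ∈ S), (if h : b ∈ S then g ⟨b, h⟩ else x' b) = g ⟨b, hb⟩ :=
    fun b hb => dif_pos hb
  refine ⟨fun b => if h : b ∈ S then g ⟨b, h⟩ else x' b, ?_, ?_, ?_, ?_⟩
  · ext a
    simp only [Function.comp_apply]
    split_ifs with h
    · exact (hg (x := ⟨f a, h⟩) ⟨a, rfl⟩).trans (hx' a)
    · exact hx' a
  · intro b hb c hc h
    simp only [hSh b hb, hSh c hc] at h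
    exact congrArg Subtype.val (hgE.inj h)
  · intro b hb
    simp only [hSh b hb]
    exact hgE.pt _
  · intro b hb c hc
    simp only [hSh b hb, hSh c hc]
    exact hgE.inc _ _

/-! ### Model completeness -/

/-- Every embedding between models of `T` is elementary. -/
lemma realize_comp_iff {m n : ℕ} (hm : 1 ≤ m) (hn : 1 ≤ n) {α : Type} {k : ℕ}
    (φ : lang.BoundedFormula α k) : ∀ {M N : Type u} [lang.Structure M] [lang.Structure N]
    [Nonempty M] [Nonempty N], M ⊨ T m n → N ⊨ T m n → ∀ (f : M ↪[lang] N) (v : α → M)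
    (xs : Fin k → M), φ.Realize (f ∘ v) (f ∘ xs) ↔ φ.Realize v xs := by
  induction φ with
  | falsum => intros; rfl
  | equal t₁ t₂ =>
    intro M N _ _ _ _ _ _ f v xs
    simp only [BoundedFormula.Realize, ← Sum.comp_elim, HomClass.realize_term]
    exact f.injective.eq_iff
  | rel R ts =>
    intro M N _ _ _ _ _ _ f v xs
    simp only [BoundedFormula.Realize, ← Sum.comp_elim, HomClass.realize_term]
    exact f.map_rel R _
  | imp φ ψ h1 h2 =>
    intro M N _ _ _ _ hM hN f v xs
    simp only [BoundedFormula.Realize, h1 hM hN, h2 hM hN]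
  | @all k φ ih =>
    intro M N _ _ _ _ hM hN f v xs
    simp only [BoundedFormula.Realize]
    refine ⟨fun H a => ?_, fun H b => ?_⟩
    · have := H (f a)
      rwa [← Fin.comp_snoc, ih hM hN] at this
    -- The values of a retraction `h S` at `b` are only approximations to `b` inside `M`. Their
    -- ultraproduct along finite `S ⊆ N` is a genuine embedding `g` of `N` into an ultrapower of
    -- `M`, diagonal on the image of `M`.
    · have hcM := (model_Tc hm hn).1 (model_Tc_of_model_T hM)
      have hcN := (model_Tc hm hn).1 (model_Tc_of_model_T hN)
      choose h hf hinj hpt hinc using fun S : Finset N =>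
        exists_extension hm hn hM (isEmb_embedding f) hcM.2.2 hcN.2.1
          (x := id) ⟨Function.injective_id, fun _ => Iff.rfl, fun _ _ => Iff.rfl⟩ S
      let U : Ultrafilter (Finset N) := Ultrafilter.of Filter.atTop
      have hU : ∀ b : N, ∀ᶠ S in (U : Filter (Finset N)), b ∈ S := fun b =>
        Ultrafilter.of_le _ ((Filter.eventually_ge_atTop {b}).mono fun S hS =>
          hS (Finset.mem_singleton_self b))
      let P := (U : Filter (Finset N)).Product fun _ => M
      have hP : P ⊨ T m n := by
        rw [Theory.model_iff]
        intro σ hσ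
        rw [Ultraproduct.sentence_realize]
        exact Filter.Eventually.of_forall fun _ => Theory.model_iff _ |>.1 hM σ hσ
      have hcP := (model_Tc hm hn).1 (model_Tc_of_model_T hP)
      let g : N → P := fun b => ((fun S => h S b : Finset N → M) : P)
      have hPpt : ∀ b, IsPoint (g b) ↔ ∀ᶠ S in (U : Filter (Finset N)), IsPoint (h S b) := by
        intro b
        have := Ultraproduct.realize_formula_cast (u := U) (M := fun _ => M)
          (pointF (0 : Fin 1)) (fun _ S => h S b)
        rwa [realize_pointF, Filter.eventually_congr (.of_forall fun S => realize_pointF)] at this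
      have hPinc : ∀ b c, Inc (g b) (g c) ↔
          ∀ᶠ S in (U : Filter (Finset N)), Inc (h S b) (h S c) := by
        intro b c
        have := Ultraproduct.realize_formula_cast (u := U) (M := fun _ => M)
          (incF (0 : Fin 2) 1) (fun i S => h S (![b, c] i))
        rwa [realize_incF, Filter.eventually_congr (.of_forall fun S => realize_incF)] at this
      have hg : Geo.IsEmb (geo N) (geo P) g := by
        refine ⟨fun b c hbc => ?_, fun b => ?_, fun b c => ?_⟩
        · have : ∀ᶠ S in (U : Filter (Finset N)), h S b = h S c := Quotient.exact hbc
          obtain ⟨S, ⟨hS, hb⟩, hc⟩ := ((this.and (hU b)).and (hU c)).exists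
          exact hinj S hb hc hS
        · rw [geo_pt, hPpt]
          refine (Filter.eventually_congr ((hU b).mono fun S hS => hpt S b hS)).trans ?_
          exact Filter.eventually_const
        · rw [hcP.1.geo_inc, hPinc]
          simp only [← hcM.1.geo_inc]
          refine (Filter.eventually_congr (((hU b).and (hU c)).mono fun S hS =>
            hinc S b hS.1 c hS.2)).trans ?_
          exact Filter.eventually_const
      -- The induction hypothesis is used for `N` and the ultrapower rather than for `M` and `N`,
      -- which is why the statement quantifies over all models after the formula.
      have key := ih hN hP (hg.toEmbedding hcN.1 hcP.1) (f ∘ v) (Fin.snoc (f ∘ xs) b)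
      have hgf : ∀ a, g (f a) = ((fun _ => a : Finset N → M) : P) := fun a =>
        congrArg _ (funext fun S => congrFun (hf S) a)
      have h1 : g ∘ f ∘ v = fun i => ((fun _ => v i : Finset N → M) : P) :=
        funext fun i => hgf (v i)
      have h2 : g ∘ (Fin.snoc (f ∘ xs) b : Fin (k + 1) → N) =
          fun i => ((fun S => Fin.snoc (α := fun _ => M) xs (h S b) i : Finset N → M) : P) := by
        funext i
        refine Fin.lastCases ?_ (fun i => ?_) i
        · simp only [Function.comp_apply, Fin.snoc_last]
          rfl
        · simp only [Function.comp_apply, Fin.snoc_castSucc]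
          exact hgf (xs i)
      refine key.1 ?_
      change φ.Realize (g ∘ f ∘ v) (g ∘ (Fin.snoc (f ∘ xs) b : Fin (k + 1) → N))
      rw [h1, h2]
      exact (Ultraproduct.boundedFormula_realize_cast φ (fun i _ => v i) _).2
        (Filter.Eventually.of_forall fun S => H _)

/-- A K_{m,n} with all its vertices in the image pulls back to `G`. Since `H` itself need not be
free, this serves to check freeness of new structures piece by piece. -/
lemma Geo.IsEmb.not_forall_inc_of_subset_range {m n : ℕ} {α β : Type*} {G : Geo α} {H : Geo β}
    {f : α → β} (hf : IsEmb G H f) (hG : G.Free m n) {P L : Finset β}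
    (hP : (P : Set β) ⊆ Set.range f) (hL : (L : Set β) ⊆ Set.range f) (hPc : P.card = m)
    (hLc : L.card = n) : ¬ ∀ p ∈ P, ∀ l ∈ L, H.inc p l := by
  classical
  have key : ∀ S : Finset β, (S : Set β) ⊆ Set.range f →
      (S.preimage f hf.inj.injOn).card = S.card := by
    intro S hS
    rw [Finset.card_preimage, Finset.filter_true_of_mem fun x hx => hS hx]
  intro h
  refine hG (P.preimage f hf.inj.injOn) (L.preimage f hf.inj.injOn)
    ((key P hP).trans hPc) ((key L hL).trans hLc) fun p hp l hl => ?_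
  exact (hf.inc _ _).1 (h _ (Finset.mem_preimage.1 hp) _ (Finset.mem_preimage.1 hl))

/-! ### Finite conditions and their one-step extensions -/

/-- A finite `K_{m,n}`-free incidence structure whose domain is a finite set of natural numbers. -/
structure Cond (m n : ℕ) where
  dom : Finset ℕ
  geo : Geo ℕ
  supp : ∀ {x y}, geo.inc x y → x ∈ dom ∧ y ∈ dom
  free : geo.Free m n

namespace Cond

variable {m n : ℕ}

/-- `C` is an induced substructure of `Q`. -/
structure Sub (C : Cond m n) (Q : Geo ℕ) : Prop where
  pt : ∀ x ∈ C.dom, Q.pt x ↔ C.geo.pt x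
  inc : ∀ x ∈ C.dom, ∀ y ∈ C.dom, Q.inc x y ↔ C.geo.inc x y

/-- Not a partial order: the type that `geo` gives to a number outside the domain is junk, and two
conditions may differ there only. -/
instance : Preorder (Cond m n) where
  le C D := C.dom ⊆ D.dom ∧ C.Sub D.geo
  le_refl C := ⟨Finset.Subset.refl _, fun _ _ => Iff.rfl, fun _ _ _ _ => Iff.rfl⟩
  le_trans _ _ _ h1 h2 := ⟨h1.1.trans h2.1,
    fun x hx => (h2.2.pt x (h1.1 hx)).trans (h1.2.pt x hx),
    fun x hx y hy => (h2.2.inc x (h1.1 hx) y (h1.1 hy)).trans (h1.2.inc x hx y hy)⟩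

lemma Sub.mono {C D : Cond m n} {Q : Geo ℕ} (h : C ≤ D) (hD : D.Sub Q) : C.Sub Q :=
  ⟨fun x hx => (hD.pt x (h.1 hx)).trans (h.2.pt x hx),
    fun x hx y hy => (hD.inc x (h.1 hx) y (h.1 hy)).trans (h.2.inc x hx y hy)⟩

/-- The dual condition. -/
def dual (C : Cond m n) : Cond n m where
  dom := C.dom
  geo := C.geo.dual
  supp h := (C.supp h).symm
  free := C.free.dual

lemma dual_le_dual {C D : Cond m n} (h : C ≤ D) : C.dual ≤ D.dual :=
  ⟨h.1, fun x hx => not_congr (h.2.pt x hx), fun x hx y hy => h.2.inc y hy x hx⟩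

lemma dual_dual (C : Cond m n) : C.dual.dual = C := by
  cases C
  simp [dual]

lemma le_dual_of_dual_le {C : Cond m n} {D : Cond n m} (h : C.dual ≤ D) : C ≤ D.dual := by
  rw [← C.dual_dual]
  exact dual_le_dual h

/-- The condition with empty domain. -/
def empty (hm : 1 ≤ m) (hn : 1 ≤ n) : Cond m n where
  dom := ∅
  geo := ⟨fun _ => True, fun _ _ => False, False.elim, False.elim⟩
  supp h := h.elim
  free P L hP hL h := by
    obtain ⟨p, hp⟩ := Finset.card_pos.1 (hP ▸ hm : 0 < P.card)
    obtain ⟨l, hl⟩ := Finset.card_pos.1 (hL ▸ hn : 0 < L.card)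
    exact h p hp l hl

/-- Elements of `S` are adjoined as isolated elements. -/
def union (C : Cond m n) (S : Finset ℕ) : Cond m n where
  dom := C.dom ∪ S
  geo := C.geo
  supp h := ⟨Finset.mem_union_left _ (C.supp h).1, Finset.mem_union_left _ (C.supp h).2⟩
  free := C.free

lemma le_union (C : Cond m n) (S : Finset ℕ) : C ≤ C.union S :=
  ⟨Finset.subset_union_left, fun _ _ => Iff.rfl, fun _ _ _ _ => Iff.rfl⟩

lemma subset_union (C : Cond m n) (S : Finset ℕ) : S ⊆ (C.union S).dom :=
  Finset.subset_union_right

/-- A new line through exactly the points in `S` can be added, provided that no `m` points in `S`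
lie on `n - 1` common lines. -/
lemma exists_addLine (C : Cond m n) {S : Finset ℕ} (hS : S ⊆ C.dom)
    (hpt : ∀ p ∈ S, C.geo.pt p) (hfree : ∀ P ⊆ S, P.card = m → ∀ L : Finset ℕ, L.card = n - 1 →
      ¬ ∀ p ∈ P, ∀ l ∈ L, C.geo.inc p l) :
    ∃ D, C ≤ D ∧ ∃ x ∉ C.dom, x ∈ D.dom ∧ ¬ D.geo.pt x ∧
      ∀ y z, D.geo.inc y z ↔ C.geo.inc y z ∨ (z = x ∧ y ∈ S) := by
  obtain ⟨x, hx⟩ := Infinite.exists_notMem_finset C.dom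
  have hne : ∀ y ∈ C.dom, y ≠ x := fun y hy h => hx (h ▸ hy)
  let G : Geo ℕ :=
    -- The junk type of `x` in `C` might be "point", so it is overridden.
    { pt := fun y => C.geo.pt y ∧ y ≠ x
      inc := fun y z => C.geo.inc y z ∨ (z = x ∧ y ∈ S)
      pt_of_inc := by
        rintro y z (h | ⟨rfl, h⟩)
        · exact ⟨C.geo.pt_of_inc h, hne _ (C.supp h).1⟩
        · exact ⟨hpt y h, hne _ (hS h)⟩
      not_pt_of_inc := by
        rintro y z (h | ⟨rfl, h⟩) ⟨h', hz⟩
        · exact C.geo.not_pt_of_inc h h'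
        · exact hz rfl }
  have hfree' : G.Free m n := by
    intro P L hP hL H
    -- A K_{m,n} through the new line leaves m points of `S` on n - 1 old lines, which `hfree`
    -- forbids.
    by_cases hxL : x ∈ L
    · refine hfree P (fun p hp => ?_) hP (L.erase x) (by rw [Finset.card_erase_of_mem hxL, hL])
        fun p hp l hl => ?_
      · rcases H p hp x hxL with h | h
        · exact absurd (C.supp h).2 hx
        · exact h.2
      · rcases H p hp l (Finset.mem_of_mem_erase hl) with h | h
        · exact h
        · exact absurd h.1 (Finset.ne_of_mem_erase hl)
    · refine C.free P L hP hL fun p hp l hl => ?_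
      rcases H p hp l hl with h | h
      · exact h
      · exact absurd (h.1 ▸ hl) hxL
  refine ⟨⟨insert x C.dom, G, ?_, hfree'⟩, ⟨Finset.subset_insert _ _, ?_, ?_⟩, x, hx,
    Finset.mem_insert_self _ _, fun h => h.2 rfl, fun y z => Iff.rfl⟩
  · rintro y z (h | ⟨rfl, h⟩)
    · exact ⟨Finset.mem_insert_of_mem (C.supp h).1, Finset.mem_insert_of_mem (C.supp h).2⟩
    · exact ⟨Finset.mem_insert_of_mem (hS h), Finset.mem_insert_self _ _⟩
  · exact fun y hy => ⟨And.left, fun h => ⟨h, hne y hy⟩⟩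
  · exact fun y hy z hz => ⟨fun h => h.resolve_right fun h => hne z hz h.1, Or.inl⟩

/-- The dual of `exists_addLine`. -/
lemma exists_addPoint (C : Cond m n) {S : Finset ℕ} (hS : S ⊆ C.dom)
    (hline : ∀ l ∈ S, ¬ C.geo.pt l) (hfree : ∀ L ⊆ S, L.card = n → ∀ P : Finset ℕ,
      P.card = m - 1 → ¬ ∀ p ∈ P, ∀ l ∈ L, C.geo.inc p l) :
    ∃ D, C ≤ D ∧ ∃ x ∉ C.dom, x ∈ D.dom ∧ D.geo.pt x ∧
      ∀ y z, D.geo.inc y z ↔ C.geo.inc y z ∨ (y = x ∧ z ∈ S) := by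
  obtain ⟨D, hD, x, hx, hxD, hxp, hinc⟩ := C.dual.exists_addLine hS hline
    fun L hL hc P hP h => hfree L hL hc P hP fun p hp l hl => h l hl p hp
  exact ⟨D.dual, le_dual_of_dual_le hD, x, hx, hxD, hxp, fun y z => hinc z y⟩

/-- Common lines are added one at a time. As long as fewer than n - 1 of them exist, a further line
through exactly `P` creates no K_{m,n}. -/
lemma exists_joins (C : Cond m n) (hm : 1 ≤ m) {P : Finset ℕ} (hP : P ⊆ C.dom) (hPc : P.card = m)
    (hpt : ∀ p ∈ P, C.geo.pt p) : ∃ D, C ≤ D ∧ ∃ L ⊆ D.dom, L.card = n - 1 ∧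
      (∀ l ∈ L, ¬ D.geo.pt l) ∧ ∀ p ∈ P, ∀ l ∈ L, D.geo.inc p l := by
  have key : ∀ j ≤ n - 1, ∃ D, C ≤ D ∧ ∃ L ⊆ D.dom, L.card = j ∧
      (∀ l ∈ L, ¬ D.geo.pt l) ∧ ∀ p ∈ P, ∀ l ∈ L, D.geo.inc p l := by
    intro j
    induction j with
    | zero => exact fun _ => ⟨C, le_rfl, ∅, by simp⟩
    | succ j ih =>
      intro hj
      obtain ⟨D, hCD, L, hL, hLc, hLpt, hinc⟩ := ih (by omega)
      by_cases hex : ∃ L ⊆ D.dom, L.card = j + 1 ∧ (∀ l ∈ L, ¬ D.geo.pt l) ∧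
          ∀ p ∈ P, ∀ l ∈ L, D.geo.inc p l
      · exact ⟨D, hCD, hex⟩
      obtain ⟨p₀, hp₀⟩ := Finset.card_pos.1 (hPc ▸ hm : 0 < P.card)
      obtain ⟨E, hDE, x, hx, hxE, hxp, hE⟩ := D.exists_addLine (hP.trans hCD.1)
        (fun p hp => (hCD.2.pt p (hP hp)).2 (hpt p hp)) (fun P' hP' hP'c L' hL' H => by
          obtain rfl : P' = P := Finset.eq_of_subset_of_card_le hP' (by omega)
          obtain ⟨L'', hsub, hL''⟩ := Finset.exists_subset_card_eq (hL' ▸ hj)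
          exact hex ⟨L'', fun l hl => (D.supp (H _ hp₀ l (hsub hl))).2, hL'',
            fun l hl => D.geo.not_pt_of_inc (H _ hp₀ l (hsub hl)),
            fun p hp l hl => H p hp l (hsub hl)⟩)
      refine ⟨E, hCD.trans hDE, insert x L, ?_, ?_, ?_, ?_⟩
      · exact Finset.insert_subset hxE (hL.trans hDE.1)
      · rw [Finset.card_insert_of_notMem fun h => hx (hL h), hLc]
      · intro l hl
        rcases Finset.mem_insert.1 hl with rfl | hl
        · exact hxp
        · rw [hDE.2.pt l (hL hl)]
          exact hLpt l hl
      · intro p hp l hl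
        rw [hE]
        rcases Finset.mem_insert.1 hl with rfl | hl
        · exact Or.inr ⟨rfl, hp⟩
        · exact Or.inl (hinc p hp l hl)
  exact key _ le_rfl

/-- Any finite `K_{m,n}`-free extension of `C` is realized by a condition extending `C`. -/
lemma exists_ge_of_isEmb (C : Cond m n) (hm : 1 ≤ m) (hn : 1 ≤ n) {B : Type*} [Finite B] {K : Geo B} (hK : K.Free m n)
    {j : C.dom → B} (hj : Geo.IsEmb (C.geo.comap Subtype.val) K j) :
    ∃ D, C ≤ D ∧ ∃ h : B → ℕ, Function.Injective h ∧ Set.range h = D.dom ∧ (∀ c, h (j c) = c) ∧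
      Geo.IsEmb K D.geo h := by
  classical
  obtain ⟨e⟩ := (Finite.exists_equiv_fin B).choose_spec
  let N := C.dom.sup id + 1
  have hN : ∀ c ∈ C.dom, c < N := fun c hc => Nat.lt_succ_of_le (Finset.le_sup (f := id) hc)
  -- Elements of `C` keep their names; all others are numbered beyond the domain of `C`.
  let h : B → ℕ := Function.extend j Subtype.val fun b => N + e b
  have hj' : ∀ c, h (j c) = c := fun c => hj.inj.extend_apply _ _ _
  have hnr : ∀ b, b ∉ Set.range j → h b = N + e b := fun b hb =>
    Function.extend_apply' _ _ _ hb
  have hinj : Function.Injective h := by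
    intro b b' hbb
    by_cases hb : b ∈ Set.range j <;> by_cases hb' : b' ∈ Set.range j
    · obtain ⟨c, rfl⟩ := hb
      obtain ⟨c', rfl⟩ := hb'
      rw [hj', hj'] at hbb
      rw [Subtype.ext hbb]
    · obtain ⟨c, rfl⟩ := hb
      rw [hj', hnr _ hb'] at hbb
      have := hN c c.2
      omega
    · obtain ⟨c, rfl⟩ := hb'
      rw [hj', hnr _ hb] at hbb
      have := hN c c.2
      omega
    · rw [hnr _ hb, hnr _ hb'] at hbb
      exact e.injective (Fin.ext (by omega))
  let G : Geo ℕ :=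
    { pt := fun y => ∃ b, h b = y ∧ K.pt b
      inc := fun y z => ∃ b c, h b = y ∧ h c = z ∧ K.inc b c
      pt_of_inc := by
        rintro y z ⟨b, c, rfl, rfl, H⟩
        exact ⟨b, rfl, K.pt_of_inc H⟩
      not_pt_of_inc := by
        rintro y z ⟨b, c, rfl, rfl, H⟩ ⟨c', hc, H'⟩
        rw [hinj hc] at H'
        exact K.not_pt_of_inc H H' }
  have hG : Geo.IsEmb K G h := by
    refine ⟨hinj, fun x => ⟨?_, fun H => ⟨x, rfl, H⟩⟩, fun x y => ⟨?_, fun H => ⟨x, y, rfl, rfl, H⟩⟩⟩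
    · rintro ⟨b, hb, H⟩
      rwa [← hinj hb]
    · rintro ⟨b, c, hb, hc, H⟩
      rwa [← hinj hb, ← hinj hc]
  have hfin : (Set.range h).Finite := Set.finite_range h
  have hfree : G.Free m n := by
    intro P L hP hL H
    obtain ⟨p, hp⟩ := Finset.card_pos.1 (hP ▸ hm : 0 < P.card)
    obtain ⟨l, hl⟩ := Finset.card_pos.1 (hL ▸ hn : 0 < L.card)
    refine hG.not_forall_inc_of_subset_range hK (fun q hq => ?_) (fun q hq => ?_) hP hL H
    · obtain ⟨b, -, hb, -⟩ := H q hq l hl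
      exact ⟨b, hb⟩
    · obtain ⟨-, b, -, hb, -⟩ := H p hp q hq
      exact ⟨b, hb⟩
  refine ⟨⟨hfin.toFinset, G, ?_, hfree⟩, ⟨?_, ?_, ?_⟩, h, hinj, by simp, hj', hG⟩
  · rintro y z ⟨b, c, rfl, rfl, H⟩
    simp
  · intro c hc
    simp only [Set.Finite.mem_toFinset]
    exact ⟨j ⟨c, hc⟩, hj' _⟩
  · intro c hc
    have := (hG.pt (j ⟨c, hc⟩)).trans (hj.pt ⟨c, hc⟩)
    rwa [hj'] at this
  · intro c hc d hd
    have := (hG.inc (j ⟨c, hc⟩) (j ⟨d, hd⟩)).trans (hj.inc ⟨c, hc⟩ ⟨d, hd⟩)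
    rwa [hj', hj'] at this

end Cond

namespace Cond

variable {m n : ℕ}

/-- The elements of `A` indexed by `Fin l` are safe over those indexed by `Fin k`. -/
structure Safe {k l : ℕ} (m n : ℕ) (A : Geo (Fin k ⊕ Fin l)) : Prop where
  free : A.Free m n
  points : ∀ (i : Fin l) (L : Finset (Fin k)), L.card = n →
    ¬ ∀ j ∈ L, A.inc (Sum.inr i) (Sum.inl j)
  lines : ∀ (i : Fin l) (P : Finset (Fin k)), P.card = m →
    ¬ ∀ j ∈ P, A.inc (Sum.inl j) (Sum.inr i)

lemma Safe.dual {k l : ℕ} {A : Geo (Fin k ⊕ Fin l)} (h : Safe m n A) : Safe n m A.dual :=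
  ⟨h.free.dual, h.lines, h.points⟩

end Cond

/-- A bound n - 1 on the number of incident elements is restated as the absence of an n-element set
of them; the types again follow from the incidences. -/
lemma IsSafe.safe {m n : ℕ} (hm : 1 ≤ m) (hn : 1 ≤ n) {k q : ℕ}
    {A : lang.Structure (Fin k ⊕ Fin q)} (h : IsSafe m n A) :
    IsGeo (Fin k ⊕ Fin q) ∧ Cond.Safe m n (geo (Fin k ⊕ Fin q)) := by
  obtain ⟨hA, hF⟩ := (model_Tp hm hn).1 h.free
  refine ⟨hA, hF, fun i L hL H => ?_, fun i P hP H => ?_⟩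
  · obtain ⟨l, hl⟩ := Finset.card_pos.1 (hL ▸ hn : 0 < L.card)
    have h1 := h.points i ((geo _).pt_of_inc (H l hl))
    have h2 := Set.ncard_le_ncard (s := (L : Set (Fin k))) (t := {j : Fin k |
      IsLine (Sum.inl j : Fin k ⊕ Fin q) ∧ Inc (Sum.inr i : Fin k ⊕ Fin q) (Sum.inl j)})
      (fun j hj => ⟨(hA.line_iff _).2 ((geo _).not_pt_of_inc (H j hj)),
        hA.geo_inc.1 (H j hj)⟩) (Set.toFinite _)
    rw [Set.ncard_coe_finset] at h2
    omega
  · obtain ⟨p, hp⟩ := Finset.card_pos.1 (hP ▸ hm : 0 < P.card)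
    have h1 := h.lines i ((hA.line_iff _).2 ((geo _).not_pt_of_inc (H p hp)))
    have h2 := Set.ncard_le_ncard (s := (P : Set (Fin k))) (t := {j : Fin k |
      IsPoint (Sum.inl j : Fin k ⊕ Fin q) ∧ Inc (Sum.inl j : Fin k ⊕ Fin q) (Sum.inr i)})
      (fun j hj => ⟨(geo _).pt_of_inc (H j hj), hA.geo_inc.1 (H j hj)⟩)
      (Set.toFinite _)
    rw [Set.ncard_coe_finset] at h2
    omega

/-! ### Free amalgamation over safe diagrams -/

namespace Cond

variable {m n : ℕ}

/-- The incidences of the free amalgam of `G` and `A` over the common part given by `x`. -/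
inductive AmalgInc {k l : ℕ} {β : Type*} (G : Geo β) (A : Geo (Fin k ⊕ Fin l)) (x : Fin k → β) :
    β ⊕ Fin l → β ⊕ Fin l → Prop
  | base {b c : β} : G.inc b c → AmalgInc G A x (Sum.inl b) (Sum.inl c)
  | ext {a a' : Fin k ⊕ Fin l} : A.inc a a' → AmalgInc G A x (Sum.map x id a) (Sum.map x id a')

/-- The free amalgam of `G` and `A` over the common part given by `x`. -/
def amalg {k l : ℕ} {β : Type*} (G : Geo β) (A : Geo (Fin k ⊕ Fin l)) {x : Fin k → β}
    (hpt : ∀ i, G.pt (x i) ↔ A.pt (Sum.inl i)) : Geo (β ⊕ Fin l) where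
  pt := Sum.elim G.pt fun i => A.pt (Sum.inr i)
  inc := AmalgInc G A x
  pt_of_inc := by
    rintro _ _ (⟨h⟩ | ⟨h⟩)
    · exact G.pt_of_inc h
    · rename_i a a'
      have := A.pt_of_inc h
      rcases a with a | a
      · exact (hpt a).2 this
      · exact this
  not_pt_of_inc := by
    rintro _ _ (⟨h⟩ | ⟨h⟩)
    · exact G.not_pt_of_inc h
    · rename_i a a'
      have := A.not_pt_of_inc h
      rcases a' with a' | a'
      · exact fun h' => this ((hpt a').1 h')
      · exact this

section Amalg

variable {k l : ℕ} {β : Type*} {G : Geo β} {A : Geo (Fin k ⊕ Fin l)} {x : Fin k → β}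

lemma isEmb_amalg_inl (hpt : ∀ i, G.pt (x i) ↔ A.pt (Sum.inl i))
    (hinc : ∀ i j, G.inc (x i) (x j) ↔ A.inc (Sum.inl i) (Sum.inl j)) :
    Geo.IsEmb G (amalg G A hpt) Sum.inl := by
  refine ⟨Sum.inl_injective, fun _ => Iff.rfl, fun b c => ⟨fun h => ?_, .base⟩⟩
  change AmalgInc G A x _ _ at h
  generalize hb : (Sum.inl b : β ⊕ Fin l) = b' at h
  generalize hc : (Sum.inl c : β ⊕ Fin l) = c' at h
  rcases h with ⟨h⟩ | @⟨a | a, a' | a', h⟩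
  · rwa [Sum.inl_injective hb, Sum.inl_injective hc]
  · rw [Sum.inl_injective hb, Sum.inl_injective hc]
    exact (hinc _ _).2 h
  · cases hc
  · cases hb
  · cases hb

lemma isEmb_amalg_map (hx : Function.Injective x) (hpt : ∀ i, G.pt (x i) ↔ A.pt (Sum.inl i))
    (hinc : ∀ i j, G.inc (x i) (x j) ↔ A.inc (Sum.inl i) (Sum.inl j)) :
    Geo.IsEmb A (amalg G A hpt) (Sum.map x id) := by
  have hinj : Function.Injective (Sum.map x id : Fin k ⊕ Fin l → β ⊕ Fin l) :=
    hx.sumMap Function.injective_id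
  refine ⟨hinj, ?_, fun a a' => ⟨fun h => ?_, .ext⟩⟩
  · rintro (i | i)
    · exact hpt i
    · exact Iff.rfl
  · change AmalgInc G A x _ _ at h
    generalize hb : Sum.map x id a = b at h
    generalize hc : Sum.map x id a' = c at h
    rcases h with ⟨h⟩ | ⟨h⟩
    · rcases a with a | a
      · rcases a' with a' | a'
        · rw [← Sum.inl_injective hb, ← Sum.inl_injective hc] at h
          exact (hinc _ _).1 h
        · cases hc
      · cases hb
    · rwa [hinj hb, hinj hc]

/-- A new element is incident only to elements of `A`. So a K_{m,n} with both a new point and a new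
line lies in `A`, one without new elements lies in `G`, and in the remaining cases a new element is
incident to n lines or m points among x̄, against safety. -/
lemma amalg_free (hx : Function.Injective x)
    (hpt : ∀ i, G.pt (x i) ↔ A.pt (Sum.inl i))
    (hinc : ∀ i j, G.inc (x i) (x j) ↔ A.inc (Sum.inl i) (Sum.inl j))
    (hA : Safe m n A) (hG : G.Free m n) : (amalg G A hpt).Free m n := by
  classical
  have hE := isEmb_amalg_map hx hpt hinc
  have hl : ∀ {i c}, AmalgInc G A x (Sum.inr i) c →
      ∃ a', Sum.map x id a' = c ∧ A.inc (Sum.inr i) a' := by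
    intro i c h
    generalize hb : (Sum.inr i : β ⊕ Fin l) = b at h
    rcases h with ⟨h⟩ | @⟨a | a, a', h⟩
    · cases hb
    · cases hb
    · cases hb
      exact ⟨a', rfl, h⟩
  have hr : ∀ {i c}, AmalgInc G A x c (Sum.inr i) →
      ∃ a', Sum.map x id a' = c ∧ A.inc a' (Sum.inr i) := by
    intro i c h
    generalize hb : (Sum.inr i : β ⊕ Fin l) = b at h
    rcases h with ⟨h⟩ | @⟨a', a | a, h⟩
    · cases hb
    · cases hb
    · cases hb
      exact ⟨a', rfl, h⟩
  intro P L hP hL H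
  have key : ∀ S : Finset (β ⊕ Fin l), (∀ i, Sum.inr i ∉ S) →
      (S : Set (β ⊕ Fin l)) ⊆ Set.range Sum.inl := by
    rintro S hS (b | b) hb
    · exact ⟨b, rfl⟩
    · exact absurd hb (hS b)
  have pull : ∀ S : Finset (β ⊕ Fin l), (∀ i, Sum.inr i ∉ S) →
      (∀ c ∈ S, c ∈ Set.range (Sum.map x id : Fin k ⊕ Fin l → β ⊕ Fin l)) →
      ∃ S' : Finset (Fin k), S'.card = S.card ∧ ∀ j ∈ S', Sum.inl (x j) ∈ S := by
    intro S hS hS'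
    have hinj : Function.Injective fun j => (Sum.inl (x j) : β ⊕ Fin l) :=
      Sum.inl_injective.comp hx
    refine ⟨S.preimage (fun j => Sum.inl (x j)) hinj.injOn, ?_, fun j hj => by simpa using hj⟩
    rw [Finset.card_preimage, Finset.filter_true_of_mem]
    intro c hc
    obtain ⟨j | j, rfl⟩ := hS' c hc
    · exact ⟨j, rfl⟩
    · exact absurd hc (hS j)
  by_cases hPr : ∃ i, Sum.inr i ∈ P
  · obtain ⟨i, hi⟩ := hPr
    have hLr : ∀ c ∈ L, c ∈ Set.range (Sum.map x id : Fin k ⊕ Fin l → β ⊕ Fin l) := fun c hc => by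
      obtain ⟨a', ha', -⟩ := hl (H _ hi c hc)
      exact ⟨a', ha'⟩
    by_cases hLi : ∃ j, Sum.inr j ∈ L
    · obtain ⟨j, hj⟩ := hLi
      refine hE.not_forall_inc_of_subset_range hA.free (fun c hc => ?_) hLr hP hL H
      obtain ⟨a', ha', -⟩ := hr (H c hc _ hj)
      exact ⟨a', ha'⟩
    · obtain ⟨S, hS, hSL⟩ := pull L (not_exists.1 hLi) hLr
      exact hA.points i S (hS.trans hL) fun j hj =>
        (hE.inc (Sum.inr i) (Sum.inl j)).1 (H _ hi _ (hSL j hj))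
  · by_cases hLi : ∃ j, Sum.inr j ∈ L
    · obtain ⟨i, hi⟩ := hLi
      obtain ⟨S, hS, hSP⟩ := pull P (not_exists.1 hPr) fun c hc => by
        obtain ⟨a', ha', -⟩ := hr (H c hc _ hi)
        exact ⟨a', ha'⟩
      exact hA.lines i S (hS.trans hP) fun j hj =>
        (hE.inc (Sum.inl j) (Sum.inr i)).1 (H _ (hSP j hj) _ hi)
    · exact (isEmb_amalg_inl hpt hinc).not_forall_inc_of_subset_range hG
        (key P (not_exists.1 hPr)) (key L (not_exists.1 hLi)) hP hL H

end Amalg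

lemma exists_amalg (C : Cond m n) (hm : 1 ≤ m) (hn : 1 ≤ n) {k l : ℕ} {A : Geo (Fin k ⊕ Fin l)}
    (hA : Safe m n A) {x : Fin k → ℕ} (hxC : ∀ i, x i ∈ C.dom) (hx : Function.Injective x)
    (hpt : ∀ i, C.geo.pt (x i) ↔ A.pt (Sum.inl i))
    (hinc : ∀ i j, C.geo.inc (x i) (x j) ↔ A.inc (Sum.inl i) (Sum.inl j)) :
    ∃ D, C ≤ D ∧ ∃ y : Fin l → ℕ, (∀ i, y i ∈ D.dom) ∧ Geo.IsEmb A D.geo (Sum.elim x y) := by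
  let x' : Fin k → C.dom := fun i => ⟨x i, hxC i⟩
  have hx' : Function.Injective x' := fun i j h => hx (congrArg Subtype.val h)
  obtain ⟨D, hD, h, hinj, hr, hh, hE⟩ := C.exists_ge_of_isEmb hm hn
    (amalg_free (G := C.geo.comap Subtype.val) hx' hpt hinc hA
      ((Geo.isEmb_comap Subtype.val_injective _).free C.free))
    (isEmb_amalg_inl (G := C.geo.comap Subtype.val) (x := x') hpt hinc)
  refine ⟨D, hD, fun i => h (Sum.inr i), fun i => ?_, ?_⟩
  · rw [← Finset.mem_coe, ← hr]
    exact ⟨_, rfl⟩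
  · convert hE.comp (isEmb_amalg_map hx' hpt hinc) using 1
    ext (i | i)
    · exact (hh (x' i)).symm
    · rfl

/-! ### Generic models -/

/-- The Rasiowa–Sikorski lemma for the order of conditions. -/
lemma exists_geo (hm : 1 ≤ m) (hn : 1 ≤ n) {ι : Type*} [Countable ι] (𝒟 : ι → Set (Cond m n))
    (h𝒟 : ∀ i, IsCofinal (𝒟 i)) :
    ∃ N : Geo ℕ, N.Free m n ∧ ∀ i, ∃ C ∈ 𝒟 i, C.Sub N := by
  classical
  let 𝒟' : ι ⊕ Finset ℕ → Order.Cofinal (Cond m n) := Sum.elim (fun i => ⟨𝒟 i, h𝒟 i⟩)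
    fun S => ⟨{C | S ⊆ C.dom}, fun C => ⟨C.union S, C.subset_union S, C.le_union S⟩⟩
  have : Encodable (ι ⊕ Finset ℕ) := Encodable.ofCountable _
  let J := Order.idealOfCofinals (empty hm hn) 𝒟'
  have hdom : ∀ S : Finset ℕ, ∃ C ∈ J, S ⊆ C.dom := fun S => by
    obtain ⟨C, hC, hCJ⟩ := Order.cofinal_meets_idealOfCofinals (empty hm hn) 𝒟' (Sum.inr S)
    exact ⟨C, hCJ, hC⟩
  -- The union of the conditions in the ideal. Membership in the domain is required for `pt` because
  -- of the junk types; the cofinal sets indexed by finite sets of naturals make every number enter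
  -- some domain.
  let N : Geo ℕ :=
    { pt := fun x => ∃ C ∈ J, x ∈ C.dom ∧ C.geo.pt x
      inc := fun x y => ∃ C ∈ J, C.geo.inc x y
      pt_of_inc := by
        rintro x y ⟨C, hC, h⟩
        exact ⟨C, hC, (C.supp h).1, C.geo.pt_of_inc h⟩
      not_pt_of_inc := by
        rintro x y ⟨C, hC, h⟩ ⟨D, hD, hy, h'⟩
        obtain ⟨E, -, hCE, hDE⟩ := J.directed C hC D hD
        rw [← hDE.2.pt y hy, hCE.2.pt y (C.supp h).2] at h'
        exact C.geo.not_pt_of_inc h h' }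
  have hsub : ∀ C ∈ J, C.Sub N := by
    intro C hC
    refine ⟨fun x hx => ⟨?_, fun h => ⟨C, hC, hx, h⟩⟩, fun x hx y hy => ⟨?_, fun h => ⟨C, hC, h⟩⟩⟩
    · rintro ⟨D, hD, hxD, h⟩
      obtain ⟨E, -, hCE, hDE⟩ := J.directed C hC D hD
      rwa [← hCE.2.pt x hx, hDE.2.pt x hxD]
    · rintro ⟨D, hD, h⟩
      obtain ⟨E, -, hCE, hDE⟩ := J.directed C hC D hD
      rwa [← hCE.2.inc x hx y hy, hDE.2.inc x (D.supp h).1 y (D.supp h).2]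
  refine ⟨N, fun P L hP hL H => ?_, fun i => ?_⟩
  · obtain ⟨C, hC, hPL⟩ := hdom (P ∪ L)
    exact C.free P L hP hL fun p hp l hl =>
      ((hsub C hC).inc p (hPL (Finset.mem_union_left _ hp)) l
        (hPL (Finset.mem_union_right _ hl))).1 (H p hp l hl)
  · obtain ⟨C, hC, hCJ⟩ := Order.cofinal_meets_idealOfCofinals (empty hm hn) 𝒟' (Sum.inl i)
    exact ⟨C, hC, hsub C hCJ⟩

/-- Given countably many cofinal sets of conditions, there is a model of `T` with domain `ℕ` which
meets all of them. -/
theorem exists_generic (hm : 1 ≤ m) (hn : 1 ≤ n) {ι : Type} [Countable ι]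
    (𝒟 : ι → Set (Cond m n)) (h𝒟 : ∀ i, IsCofinal (𝒟 i)) :
    ∃ N : Geo ℕ, (letI := N.toStructure; ℕ ⊨ T m n) ∧ ∀ i, ∃ C ∈ 𝒟 i, C.Sub N := by
  classical
  have hcount : ∀ k l : ℕ, Countable (Geo (Fin k ⊕ Fin l)) := fun k l =>
    Function.Injective.countable (β := (Fin k ⊕ Fin l → Prop) × (Fin k ⊕ Fin l → Fin k ⊕ Fin l →
      Prop)) (f := fun A => (A.pt, A.inc)) fun A B h => by
        simp only [Prod.mk.injEq] at h
        exact Geo.ext h.1 h.2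
  let J := ι ⊕ Finset ℕ ⊕ Finset ℕ ⊕ Σ kl : ℕ × ℕ, Geo (Fin kl.1 ⊕ Fin kl.2) × (Fin kl.1 → ℕ)
  -- Besides the prescribed sets, these handle the joins of each set of points, the meets of each
  -- set of lines, and each safe diagram over each tuple x̄ of naturals.
  let E : J → Set (Cond m n) := Sum.elim 𝒟 <| Sum.elim
    (fun P => {C | P ⊆ C.dom ∧ (P.card = m → (∀ p ∈ P, C.geo.pt p) → ∃ L ⊆ C.dom, L.card = n - 1 ∧
      (∀ l ∈ L, ¬ C.geo.pt l) ∧ ∀ p ∈ P, ∀ l ∈ L, C.geo.inc p l)}) <| Sum.elim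
    (fun P => {C | P ⊆ C.dom ∧ (P.card = n → (∀ p ∈ P, ¬ C.geo.pt p) → ∃ L ⊆ C.dom,
      L.card = m - 1 ∧ (∀ l ∈ L, C.geo.pt l) ∧ ∀ p ∈ P, ∀ l ∈ L, C.geo.inc l p)})
    (fun i => {C | (∀ j, i.2.2 j ∈ C.dom) ∧ (Safe m n i.2.1 → Function.Injective i.2.2 →
      (∀ j, C.geo.pt (i.2.2 j) ↔ i.2.1.pt (Sum.inl j)) →
      (∀ j j', C.geo.inc (i.2.2 j) (i.2.2 j') ↔ i.2.1.inc (Sum.inl j) (Sum.inl j')) →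
      ∃ y, (∀ j, y j ∈ C.dom) ∧ Geo.IsEmb i.2.1 C.geo (Sum.elim i.2.2 y))})
  have hE : ∀ i, IsCofinal (E i) := by
    rintro (i | P | P | ⟨⟨k, l⟩, A, x⟩) C
    · exact h𝒟 i C
    · by_cases h : P.card = m ∧ ∀ p ∈ P, C.geo.pt p
      · obtain ⟨D, hD, hL⟩ := (C.union P).exists_joins hm (C.subset_union P) h.1 h.2
        exact ⟨D, ⟨(C.subset_union P).trans hD.1, fun _ _ => hL⟩, (C.le_union P).trans hD⟩
      · exact ⟨C.union P, ⟨C.subset_union P, fun h1 h2 => absurd ⟨h1, h2⟩ h⟩, C.le_union P⟩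
    · by_cases h : P.card = n ∧ ∀ p ∈ P, ¬ C.geo.pt p
      · obtain ⟨D, hD, L, hL, hLc, hLpt, hinc⟩ :=
          (C.union P).dual.exists_joins hn (C.subset_union P) h.1 h.2
        refine ⟨D.dual, ⟨(C.subset_union P).trans hD.1, fun _ _ => ⟨L, hL, hLc, hLpt, hinc⟩⟩,
          (C.le_union P).trans (le_dual_of_dual_le hD)⟩
      · exact ⟨C.union P, ⟨C.subset_union P, fun h1 h2 => absurd ⟨h1, h2⟩ h⟩, C.le_union P⟩
    · let C' := C.union (Finset.univ.image x)
      have hx : ∀ j, x j ∈ C'.dom := fun j =>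
        C.subset_union _ (Finset.mem_image_of_mem x (Finset.mem_univ j))
      by_cases h : Safe m n A ∧ Function.Injective x ∧ (∀ j, C'.geo.pt (x j) ↔ A.pt (Sum.inl j)) ∧
        ∀ j j', C'.geo.inc (x j) (x j') ↔ A.inc (Sum.inl j) (Sum.inl j')
      · obtain ⟨D, hD, y, hy⟩ := C'.exists_amalg hm hn h.1 hx h.2.1 h.2.2.1 h.2.2.2
        exact ⟨D, ⟨fun j => hD.1 (hx j), fun _ _ _ _ => ⟨y, hy⟩⟩, (C.le_union _).trans hD⟩
      · exact ⟨C', ⟨hx, fun h1 h2 h3 h4 => absurd ⟨h1, h2, h3, h4⟩ h⟩, C.le_union _⟩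
  obtain ⟨N, hF, hN⟩ := exists_geo hm hn E hE
  refine ⟨N, ?_, fun i => hN (Sum.inl i)⟩
  let _ := N.toStructure
  have hg : Incidence.geo ℕ = N := N.geo_toStructure
  have hNG : IsGeo ℕ := N.isGeo
  rw [T, Theory.model_union_iff, model_Tc hm hn, hg]
  refine ⟨⟨N.isGeo, hF, fun P hP hpt => ?_, fun P hP hpt => ?_⟩, ?_⟩
  · obtain ⟨C, ⟨hPC, hC⟩, hCN⟩ := hN (Sum.inr (Sum.inl P))
    obtain ⟨L, hL, hLc, hLpt, hinc⟩ := hC hP fun p hp => (hCN.pt p (hPC hp)).1 (hpt p hp)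
    exact ⟨L, hLc, fun l hl => by rw [hCN.pt l (hL hl)]; exact hLpt l hl,
      fun p hp l hl => (hCN.inc p (hPC hp) l (hL hl)).2 (hinc p hp l hl)⟩
  · obtain ⟨C, ⟨hPC, hC⟩, hCN⟩ := hN (Sum.inr (Sum.inr (Sum.inl P)))
    obtain ⟨L, hL, hLc, hLpt, hinc⟩ := hC hP fun p hp => by
      rw [← hCN.pt p (hPC hp)]; exact hpt p hp
    exact ⟨L, hLc, fun l hl => not_not.2 ((hCN.pt l (hL hl)).2 (hLpt l hl)),
      fun p hp l hl => (hCN.inc l (hL hl) p (hPC hp)).2 (hinc p hp l hl)⟩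
  · rw [Theory.model_iff]
    rintro _ ⟨k, l, A, hA, rfl⟩
    obtain ⟨hAG, hAs⟩ := hA.safe hm hn
    rw [realize_extensionAx]
    intro x hx
    obtain ⟨h1, -, h3, h4⟩ := realize_diagram.1 hx
    obtain ⟨C, ⟨hxC, hC⟩, hCN⟩ := hN (Sum.inr (Sum.inr (Sum.inr ⟨(k, l),
      Incidence.geo (Fin k ⊕ Fin l), x⟩)))
    have hNinc : ∀ a b : ℕ, Inc a b ↔ N.inc a b := fun _ _ => Iff.rfl
    have hNpt : ∀ a : ℕ, IsPoint a ↔ N.pt a := fun _ => Iff.rfl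
    obtain ⟨y, hy, hyE⟩ := hC hAs (fun i j h => Sum.inl_injective ((h4 i j).1 h))
      (fun j => (hCN.pt _ (hxC j)).symm.trans (h1 j))
      (fun j j' => (hCN.inc _ (hxC j) _ (hxC j')).symm.trans
        ((h3 j j').trans hAG.geo_inc.symm))
    have hdom : ∀ b, Sum.elim x y b ∈ C.dom := by
      rintro (b | b)
      · exact hxC b
      · exact hy b
    refine ⟨y, realize_diagram.2 ⟨fun b => ?_, fun b => ?_, fun b c => ?_, fun b c => ?_⟩⟩
    · exact (hCN.pt _ (hdom b)).trans (hyE.pt b)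
    · rw [hNG.line_iff, hAG.line_iff]
      exact not_congr ((hCN.pt _ (hdom b)).trans (hyE.pt b))
    · exact (hCN.inc _ (hdom b) _ (hdom c)).trans ((hyE.inc b c).trans hAG.geo_inc)
    · exact hyE.inj.eq_iff

end Cond

/-! ### Part (a): a prime model from finite completions -/

lemma Geo.IsEmb.joins_of_surjective {m n : ℕ} {α β : Type*} {G : Geo α} {H : Geo β} {f : α → β}
    (hf : IsEmb G H f) (hs : Function.Surjective f) (hG : G.Joins m n) : H.Joins m n := by
  classical
  intro P hP hpt
  obtain ⟨P, rfl⟩ : ∃ P' : Finset α, P'.map ⟨f, hf.inj⟩ = P := by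
    refine ⟨P.preimage f hf.inj.injOn, Finset.ext fun y => ?_⟩
    obtain ⟨x, rfl⟩ := hs y
    simp
  obtain ⟨L, hL, hLpt, hinc⟩ := hG P (by simpa using hP) fun p hp =>
    (hf.pt p).1 (hpt _ (Finset.mem_map_of_mem _ hp))
  refine ⟨L.map ⟨f, hf.inj⟩, by simpa using hL, ?_, ?_⟩
  · simpa [hf.pt] using hLpt
  · simpa [hf.inc] using hinc

lemma Geo.IsEmb.complete_of_surjective {m n : ℕ} {α β : Type*} {G : Geo α} {H : Geo β} {f : α → β}
    (hf : IsEmb G H f) (hs : Function.Surjective f) (hG : G.Complete m n) : H.Complete m n :=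
  ⟨hf.joins_of_surjective hs hG.1, hf.dual.joins_of_surjective hs hG.2⟩

/-- Every finite `K_{m,n}`-free incidence structure embeds into every model of `T`. -/
lemma exists_isEmb_of_finite {m n : ℕ} (hm : 1 ≤ m) (hn : 1 ≤ n) {M : Type*} [lang.Structure M]
    [Nonempty M] (hT : M ⊨ T m n) {β : Type*} [Finite β] {H : Geo β} (hH : H.Free m n) :
    ∃ f : β → M, Geo.IsEmb H (geo M) f := by
  have key : ∀ (r : ℕ), 1 ≤ r → ∀ L : Finset β, (L : Set β) ⊆ ∅ → L.card ≠ r := by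
    intro r hr L hL
    rw [Finset.coe_eq_empty.1 (Set.subset_empty_iff.1 hL)]
    simp; omega
  -- With no variables x̄, safety is vacuous because m and n are positive.
  obtain ⟨f, -, hf⟩ := exists_extension_of_safe hm hn hT hH ∅ (fun _ => Classical.arbitrary M)
    (by simp) (by simp) (by simp) (fun _ _ L hL hc => absurd hc (key n hn L hL))
    (fun _ _ L hL hc => absurd hc (key m hm L hL))
  exact ⟨f, hf⟩

/-- The union of an increasing chain of finite complete substructures embeds into every model
of `T`. -/
lemma exists_isEmb_of_locally_complete {m n : ℕ} (hm : 1 ≤ m) (hn : 1 ≤ n) {M : Type*}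
    [lang.Structure M] [Nonempty M] (hT : M ⊨ T m n) {N : Geo ℕ} (hN : N.Free m n)
    (hloc : ∀ k, ∃ S : Finset ℕ, Finset.range k ⊆ S ∧
      (N.comap (Subtype.val : S → ℕ)).Complete m n) :
    ∃ f : ℕ → M, Geo.IsEmb N (geo M) f := by
  classical
  let State := {p : Finset ℕ × (ℕ → M) // (N.comap (Subtype.val : p.1 → ℕ)).Complete m n ∧
    Geo.IsEmb (N.comap (Subtype.val : p.1 → ℕ)) (geo M) fun x => p.2 x}
  have hemb : ∀ S : Finset ℕ, Geo.IsEmb (N.comap (Subtype.val : S → ℕ)) N Subtype.val :=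
    fun S => Geo.isEmb_comap Subtype.val_injective N
  have step : ∀ (p : State) (k : ℕ), ∃ q : State, p.1.1 ⊆ q.1.1 ∧ Finset.range k ⊆ q.1.1 ∧
      ∀ x ∈ p.1.1, q.1.2 x = p.1.2 x := by
    rintro ⟨⟨S, f⟩, hS, hf⟩ k
    -- The second bound makes `S'` contain `S`.
    obtain ⟨S', hS', hc⟩ := hloc (max k (S.sup id + 1))
    obtain ⟨h, hh, hinj, hpt, hinc⟩ := exists_extension hm hn hT (hemb S) hS hN hf S'
    refine ⟨⟨⟨S', h⟩, hc, ?_, ?_, ?_⟩, ?_, ?_, ?_⟩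
    · exact fun x y hxy => Subtype.ext (hinj x.2 y.2 hxy)
    · exact fun x => hpt x x.2
    · exact fun x y => hinc x x.2 y y.2
    · refine fun x hx => hS' (Finset.mem_range.2 ?_)
      have : x ≤ S.sup id := Finset.le_sup (f := id) hx
      omega
    · exact fun x hx => hS' (Finset.mem_range.2 (lt_max_of_lt_left (Finset.mem_range.1 hx)))
    · exact fun x hx => congrFun hh ⟨x, hx⟩
  choose next hsub hran heq using step
  obtain ⟨S₀, -, hS₀⟩ := hloc 0
  obtain ⟨f₀, hf₀⟩ := exists_isEmb_of_finite hm hn hT ((hemb S₀).free hN)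
  let p₀ : State := ⟨⟨S₀, fun x => if h : x ∈ S₀ then f₀ ⟨x, h⟩ else Classical.arbitrary M⟩, hS₀, by
    convert hf₀ using 1
    ext x
    simp⟩
  let st : ℕ → State := fun k => Nat.rec p₀ (fun k p => next p (k + 1)) k
  have hst : ∀ k, st (k + 1) = next (st k) (k + 1) := fun k => rfl
  have hmono : ∀ j k, j ≤ k → (st j).1.1 ⊆ (st k).1.1 ∧
      ∀ x ∈ (st j).1.1, (st k).1.2 x = (st j).1.2 x := by
    intro j k hjk
    induction k, hjk using Nat.le_induction with
    | base => exact ⟨Finset.Subset.refl _, fun _ _ => rfl⟩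
    | succ k _ ih =>
      rw [hst]
      exact ⟨ih.1.trans (hsub _ _), fun x hx => (heq _ _ x (ih.1 hx)).trans (ih.2 x hx)⟩
  have hmem : ∀ x k, x < k → x ∈ (st k).1.1 := by
    intro x k hx
    obtain ⟨k, rfl⟩ := Nat.exists_eq_succ_of_ne_zero (by omega : k ≠ 0)
    exact hran (st k) (k + 1) (Finset.mem_range.2 hx)
  -- Stage x + 1 is certain to contain x, and later stages do not change its value, so the limit map
  -- is read off there.
  have hF : ∀ x k, x < k → (st (x + 1)).1.2 x = (st k).1.2 x := fun x k hx =>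
    ((hmono (x + 1) k hx).2 x (hmem x _ (Nat.lt_succ_self x))).symm
  refine ⟨fun x => (st (x + 1)).1.2 x, fun x y hxy => ?_, fun x => ?_, fun x y => ?_⟩
  · have hx : x < max x y + 1 := Nat.lt_succ_of_le (le_max_left _ _)
    have hy : y < max x y + 1 := Nat.lt_succ_of_le (le_max_right _ _)
    simp only [hF x _ hx, hF y _ hy] at hxy
    exact congrArg Subtype.val (@(st (max x y + 1)).2.2.inj ⟨x, hmem x _ hx⟩ ⟨y, hmem y _ hy⟩ hxy)
  · exact (st (x + 1)).2.2.pt ⟨x, hmem x _ (Nat.lt_succ_self x)⟩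
  · have hx : x < max x y + 1 := Nat.lt_succ_of_le (le_max_left _ _)
    have hy : y < max x y + 1 := Nat.lt_succ_of_le (le_max_right _ _)
    simp only [hF x _ hx, hF y _ hy]
    exact (st (max x y + 1)).2.2.inc ⟨x, hmem x _ hx⟩ ⟨y, hmem y _ hy⟩

lemma Cond.Sub.comap_eq {m n : ℕ} {C : Cond m n} {N : Geo ℕ} (h : C.Sub N) :
    N.comap (Subtype.val : C.dom → ℕ) = C.geo.comap Subtype.val := by
  ext x y
  · exact h.pt x x.2
  · exact h.inc x x.2 y y.2

/-- If every finite model of `Tp m n` embeds in a finite model of `Tc m n`, then `T m n` has a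
prime model. -/
theorem hasPrimeModel_T {m n : ℕ} (hm : 1 ≤ m) (hn : 1 ≤ n)
    (H : ∀ (A : Type) [Finite A] [lang.Structure A], A ⊨ Tp m n →
      ∃ (B : Type) (_ : Finite B) (_ : lang.Structure B), B ⊨ Tc m n ∧ Nonempty (A ↪[lang] B)) :
    HasPrimeModel.{u} (T m n) := by
  obtain ⟨N, hNT, hN⟩ := Cond.exists_generic hm hn
    (fun k : ℕ => {C : Cond m n | Finset.range k ⊆ C.dom ∧
      (C.geo.comap (Subtype.val : C.dom → ℕ)).Complete m n}) <| by
    intro k C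
    let C' := C.union (Finset.range k)
    let A := C'.geo.comap (Subtype.val : C'.dom → ℕ)
    have hAF : A.Free m n := (Geo.isEmb_comap Subtype.val_injective _).free C'.free
    let _ := A.toStructure
    have hA : geo C'.dom = A := A.geo_toStructure
    -- Cofinality is where finite completions are needed: the completion of `C'` is renamed to a
    -- condition above `C'`.
    obtain ⟨B, _, _, hB, ⟨j⟩⟩ := H C'.dom ((model_Tp hm hn).2 ⟨A.isGeo, by rwa [hA]⟩)
    obtain ⟨hBG, hBF, hBC⟩ := (model_Tc hm hn).1 hB
    have hj := isEmb_embedding j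
    rw [hA] at hj
    obtain ⟨D, hD, h, hinj, hr, -, hE⟩ := C'.exists_ge_of_isEmb hm hn hBF hj
    have hmem : ∀ b, h b ∈ D.dom := fun b => by
      rw [← Finset.mem_coe, ← hr]
      exact ⟨b, rfl⟩
    refine ⟨D, ⟨(C.subset_union _).trans hD.1, ?_⟩, (C.le_union _).trans hD⟩
    refine Geo.IsEmb.complete_of_surjective (G := geo B) (f := fun b => ⟨h b, hmem b⟩)
      ⟨fun b c hbc => hinj (congrArg Subtype.val hbc), hE.pt, hE.inc⟩ ?_ hBC
    rintro ⟨x, hx⟩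
    obtain ⟨b, rfl⟩ : x ∈ Set.range h := by rw [hr]; exact hx
    exact ⟨b, rfl⟩
  let _ := N.toStructure
  have hg : geo ℕ = N := N.geo_toStructure
  have hNF : N.Free m n := by
    have := ((model_Tc hm hn).1 (model_Tc_of_model_T hNT)).2.1
    rwa [hg] at this
  have hNT' : ℕ ⊨ T m n := hNT
  refine ⟨Theory.ModelType.of (T m n) ℕ, fun P => ?_⟩
  obtain ⟨f, hf⟩ := exists_isEmb_of_locally_complete hm hn P.is_model hNF fun k => by
    obtain ⟨C, ⟨hk, hC⟩, hCN⟩ := hN k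
    exact ⟨C.dom, hk, by rwa [hCN.comap_eq]⟩
  rw [← hg] at hf
  have hPG := ((model_Tc hm hn).1 (model_Tc_of_model_T P.is_model)).1
  let f' : ℕ ↪[lang] P := hf.toEmbedding N.isGeo hPG
  -- `realize_comp_iff` compares models in one universe, so ℕ is lifted to that of `P`.
  let Q := Theory.ModelType.ulift.{0, 0, 0, u} (Theory.ModelType.of (T m n) ℕ)
  let e : ℕ ≃[lang] Q := Equiv.ulift.{u, 0}.symm.inducedStructureEquiv
  refine ⟨⟨f', fun k φ v => ?_⟩⟩
  have h1 := realize_comp_iff hm hn φ Q.is_model P.is_model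
    (f'.comp e.symm.toEmbedding) (e ∘ v) default
  have h2 := StrongHomClass.realize_formula e φ (v := v)
  have h3 : (f'.comp e.symm.toEmbedding) ∘ (e ∘ v) = f' ∘ v :=
    funext fun i => congrArg f' (e.symm_apply_apply (v i))
  rw [h3] at h1
  refine Iff.trans (Iff.trans ?_ h1) (Iff.trans ?_ h2)
  · exact iff_of_eq (congrArg (BoundedFormula.Realize φ (f' ∘ v)) (Subsingleton.elim _ _))
  · exact iff_of_eq (congrArg (BoundedFormula.Realize φ (e ∘ v)) (Subsingleton.elim _ _))

/-! ### Part (b): partial planes and tracked elements -/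

namespace Geo

variable {α : Type*} {G : Geo α}

lemma Free.eq_of_inc (hG : G.Free 2 2) {p q l l' : α} (hpq : p ≠ q) (h1 : G.inc p l)
    (h2 : G.inc q l) (h3 : G.inc p l') (h4 : G.inc q l') : l = l' := by
  classical
  by_contra hl
  refine hG {p, q} {l, l'} (Finset.card_pair hpq) (Finset.card_pair hl) ?_
  simp [h1, h2, h3, h4]

lemma Complete.exists_join (hG : G.Complete 2 2) {p q : α} (hpq : p ≠ q) (hp : G.pt p)
    (hq : G.pt q) : ∃ l, G.inc p l ∧ G.inc q l := by
  classical
  obtain ⟨L, hL, -, h⟩ := hG.1 {p, q} (Finset.card_pair hpq) (by simp [hp, hq])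
  obtain ⟨l, rfl⟩ := Finset.card_eq_one.1 hL
  exact ⟨l, by simpa using h⟩

lemma Complete.exists_meet (hG : G.Complete 2 2) {g h : α} (hgh : g ≠ h) (hg : ¬ G.pt g)
    (hh : ¬ G.pt h) : ∃ p, G.inc p g ∧ G.inc p h :=
  hG.dual.exists_join hgh hg hh

lemma complete_two (h1 : ∀ p q, p ≠ q → G.pt p → G.pt q → ∃ l, G.inc p l ∧ G.inc q l)
    (h2 : ∀ g h, g ≠ h → ¬ G.pt g → ¬ G.pt h → ∃ p, G.inc p g ∧ G.inc p h) :
    G.Complete 2 2 := by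
  classical
  have key : ∀ H : Geo α, (∀ p q, p ≠ q → H.pt p → H.pt q → ∃ l, H.inc p l ∧ H.inc q l) →
      H.Joins 2 2 := by
    intro H h P hP hpt
    obtain ⟨p, q, hpq, rfl⟩ := Finset.card_eq_two.1 hP
    obtain ⟨l, hl⟩ := h p q hpq (hpt p (by simp)) (hpt q (by simp))
    exact ⟨{l}, by simp, by simpa using H.not_pt_of_inc hl.1, by simpa using hl⟩
  exact ⟨key G h1, key G.dual h2⟩

end Geo

namespace Cond

lemma exists_addLine_two (C : Cond 2 2) {S : Finset ℕ} (hS : S ⊆ C.dom)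
    (hpt : ∀ p ∈ S, C.geo.pt p)
    (hfree : ∀ p ∈ S, ∀ q ∈ S, p ≠ q → ∀ l, C.geo.inc p l → ¬ C.geo.inc q l) :
    ∃ D, C ≤ D ∧ ∃ x ∉ C.dom, x ∈ D.dom ∧ ¬ D.geo.pt x ∧
      ∀ y z, D.geo.inc y z ↔ C.geo.inc y z ∨ (z = x ∧ y ∈ S) := by
  refine C.exists_addLine hS hpt fun P hP hPc L hL H => ?_
  obtain ⟨p, q, hpq, rfl⟩ := Finset.card_eq_two.1 hPc
  obtain ⟨l, rfl⟩ := Finset.card_eq_one.1 hL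
  exact hfree p (hP (by simp)) q (hP (by simp)) hpq l (H p (by simp) l (by simp))
    (H q (by simp) l (by simp))

lemma exists_addPoint_two (C : Cond 2 2) {g h : ℕ} (hg : g ∈ C.dom) (hh : h ∈ C.dom)
    (hgl : ¬ C.geo.pt g) (hhl : ¬ C.geo.pt h)
    (hfree : ∀ p, C.geo.inc p g → ¬ C.geo.inc p h) :
    ∃ D, C ≤ D ∧ ∃ x ∉ C.dom, x ∈ D.dom ∧ D.geo.pt x ∧
      ∀ y z, D.geo.inc y z ↔ C.geo.inc y z ∨ (y = x ∧ (z = g ∨ z = h)) := by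
  have := C.exists_addPoint (S := {g, h}) (by intro x; simp; rintro (rfl | rfl) <;> assumption)
    (by simp [hgl, hhl]) fun L hL hLc P hP H => by
      obtain ⟨p, rfl⟩ := Finset.card_eq_one.1 hP
      obtain rfl : L = {g, h} :=
        Finset.eq_of_subset_of_card_le hL (hLc ▸ Finset.card_le_two)
      exact hfree p (H p (by simp) g (by simp)) (H p (by simp) h (by simp))
  simpa using this

section Tracked

variable {M ι : Type*} {G : Geo M} {a : ι → M} {a' : ι → ℕ}

/-- The map `e` embeds `G` into the `K_{2,2}`-free extension `Q` of `D`, and sends the tuple `a` to `a'`. -/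
structure Wit (G : Geo M) (a : ι → M) (a' : ι → ℕ) (D : Cond 2 2) (Q : Geo ℕ) (e : M → ℕ) :
    Prop where
  sub : D.Sub Q
  free : Q.Free 2 2
  emb : Geo.IsEmb G Q e
  map : ∀ i, e (a i) = a' i

/-- The element `z` of `D` is the image of a fixed element of `M` under all embeddings as
in `Wit`. -/
def Tracked (G : Geo M) (a : ι → M) (a' : ι → ℕ) (D : Cond 2 2) (z : ℕ) : Prop :=
  z ∈ D.dom ∧ ∃ w, ∀ Q e, Wit G a a' D Q e → e w = z

lemma Wit.mono {D D' : Cond 2 2} (h : D ≤ D') {Q : Geo ℕ} {e : M → ℕ} (hW : Wit G a a' D' Q e) :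
    Wit G a a' D Q e :=
  ⟨hW.sub.mono h, hW.free, hW.emb, hW.map⟩

lemma Tracked.mono {D D' : Cond 2 2} (h : D ≤ D') {z : ℕ} (hz : Tracked G a a' D z) :
    Tracked G a a' D' z :=
  ⟨h.1 hz.1, hz.2.imp fun _ hw Q e hW => hw Q e (hW.mono h)⟩

/-- Every compatible embedding sends the line of `G` joining the two fixed preimages to a line
through `p` and `q`, and by freeness this is `l`. The existence of one witness shows that the
preimages are distinct points. -/
lemma Tracked.join (hG : G.Complete 2 2) {D : Cond 2 2} (hD : ∃ Q e, Wit G a a' D Q e)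
    {p q l : ℕ} (hp : Tracked G a a' D p) (hq : Tracked G a a' D q) (hpq : p ≠ q)
    (h1 : D.geo.inc p l) (h2 : D.geo.inc q l) : Tracked G a a' D l := by
  obtain ⟨hpD, v, hv⟩ := hp
  obtain ⟨hqD, w, hw⟩ := hq
  obtain ⟨Q, e, hW⟩ := hD
  have hlD := (D.supp h1).2
  have hpt : ∀ {u z}, e u = z → z ∈ D.dom → D.geo.inc z l → G.pt u := fun hu hz hl => by
    rw [← hW.emb.pt, hu, hW.sub.pt _ hz]
    exact D.geo.pt_of_inc hl
  obtain ⟨k, hk1, hk2⟩ := hG.exists_join (p := v) (q := w)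
    (by rintro rfl; exact hpq ((hv Q e hW).symm.trans (hw Q e hW)))
    (hpt (hv Q e hW) hpD h1) (hpt (hw Q e hW) hqD h2)
  refine ⟨hlD, k, fun Q e hW => ?_⟩
  have e1 := (hW.emb.inc _ _).2 hk1
  have e2 := (hW.emb.inc _ _).2 hk2
  rw [hv Q e hW] at e1
  rw [hw Q e hW] at e2
  exact hW.free.eq_of_inc hpq e1 e2 ((hW.sub.inc _ hpD _ hlD).2 h1)
    ((hW.sub.inc _ hqD _ hlD).2 h2)

lemma Tracked.meet (hG : G.Complete 2 2) {D : Cond 2 2} (hD : ∃ Q e, Wit G a a' D Q e)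
    {g h p : ℕ} (hg : Tracked G a a' D g) (hh : Tracked G a a' D h) (hgh : g ≠ h)
    (h1 : D.geo.inc p g) (h2 : D.geo.inc p h) : Tracked G a a' D p := by
  obtain ⟨hgD, v, hv⟩ := hg
  obtain ⟨hhD, w, hw⟩ := hh
  obtain ⟨Q, e, hW⟩ := hD
  have hpD := (D.supp h1).1
  have hpt : ∀ {u z}, e u = z → z ∈ D.dom → D.geo.inc p z → ¬ G.pt u := fun hu hz hl => by
    rw [← hW.emb.pt, hu, hW.sub.pt _ hz]
    exact D.geo.not_pt_of_inc hl
  obtain ⟨k, hk1, hk2⟩ := hG.exists_meet (g := v) (h := w)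
    (by rintro rfl; exact hgh ((hv Q e hW).symm.trans (hw Q e hW)))
    (hpt (hv Q e hW) hgD h1) (hpt (hw Q e hW) hhD h2)
  refine ⟨hpD, k, fun Q e hW => ?_⟩
  have e1 := (hW.emb.inc _ _).2 hk1
  have e2 := (hW.emb.inc _ _).2 hk2
  rw [hv Q e hW] at e1
  rw [hw Q e hW] at e2
  by_contra hne
  exact hgh (hW.free.eq_of_inc hne e1 ((hW.sub.inc _ hpD _ hgD).2 h1) e2
    ((hW.sub.inc _ hpD _ hhD).2 h2))

/-- Three tracked points which are pairwise not joined can be made collinear or not, and at most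
one of these two choices is compatible with `G`. -/
lemma exists_no_wit_of_not_joined (hG : G.Complete 2 2) {D : Cond 2 2} {s₁ s₂ s₃ : ℕ}
    (ht₁ : Tracked G a a' D s₁) (ht₂ : Tracked G a a' D s₂) (ht₃ : Tracked G a a' D s₃)
    (hp₁ : D.geo.pt s₁) (hp₂ : D.geo.pt s₂) (hp₃ : D.geo.pt s₃)
    (h₁₂ : s₁ ≠ s₂) (h₁₃ : s₁ ≠ s₃) (h₂₃ : s₂ ≠ s₃)
    (hj₁₂ : ∀ l, D.geo.inc s₁ l → ¬ D.geo.inc s₂ l) (hj₁₃ : ∀ l, D.geo.inc s₁ l → ¬ D.geo.inc s₃ l)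
    (hj₂₃ : ∀ l, D.geo.inc s₂ l → ¬ D.geo.inc s₃ l) :
    ∃ E, D ≤ E ∧ ¬ ∃ Q e, Wit G a a' E Q e := by
  by_contra! hno
  obtain ⟨hD₁, w₁, hw₁⟩ := ht₁
  obtain ⟨hD₂, w₂, hw₂⟩ := ht₂
  obtain ⟨hD₃, w₃, hw₃⟩ := ht₃
  -- In `E` the new line misses `s₃`, in `E'` it passes through it. The line `k` of `G` joining the
  -- preimages of `s₁` and `s₂` goes to `l` in the first case and to `l'` in the second, so `w₃`
  -- would be both off and on `k`.
  obtain ⟨E, hDE, l, hl, hlE, -, hE⟩ := D.exists_addLine_two (S := {s₁, s₂})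
    (by intro x; simp; rintro (rfl | rfl) <;> assumption) (by simp [hp₁, hp₂]) (by
      simp only [Finset.mem_insert, Finset.mem_singleton]
      grind)
  obtain ⟨E', hDE', l', hl', hlE', -, hE'⟩ := D.exists_addLine_two (S := {s₁, s₂, s₃})
    (by intro x; simp; rintro (rfl | rfl | rfl) <;> assumption) (by simp [hp₁, hp₂, hp₃]) (by
      simp only [Finset.mem_insert, Finset.mem_singleton]
      grind)
  simp only [Finset.mem_insert, Finset.mem_singleton] at hE hE'
  obtain ⟨Q, e, hW⟩ := hno E hDE
  obtain ⟨Q', e', hW'⟩ := hno E' hDE'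
  have a₁ := hw₁ Q e (hW.mono hDE)
  have a₂ := hw₂ Q e (hW.mono hDE)
  have a₃ := hw₃ Q e (hW.mono hDE)
  have b₁ := hw₁ Q' e' (hW'.mono hDE')
  have b₂ := hw₂ Q' e' (hW'.mono hDE')
  have b₃ := hw₃ Q' e' (hW'.mono hDE')
  obtain ⟨k, hk₁, hk₂⟩ := hG.exists_join (p := w₁) (q := w₂)
    (by rintro rfl; exact h₁₂ (a₁.symm.trans a₂))
    (by rwa [← hW.emb.pt, a₁, (hW.mono hDE).sub.pt _ hD₁])
    (by rwa [← hW.emb.pt, a₂, (hW.mono hDE).sub.pt _ hD₂])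
  have hek : e k = l := by
    have c₁ := (hW.emb.inc _ _).2 hk₁
    have c₂ := (hW.emb.inc _ _).2 hk₂
    rw [a₁] at c₁
    rw [a₂] at c₂
    refine hW.free.eq_of_inc h₁₂ c₁ c₂ ?_ ?_
    · rw [hW.sub.inc _ (hDE.1 hD₁) _ hlE, hE]; simp
    · rw [hW.sub.inc _ (hDE.1 hD₂) _ hlE, hE]; simp
  have hek' : e' k = l' := by
    have c₁ := (hW'.emb.inc _ _).2 hk₁
    have c₂ := (hW'.emb.inc _ _).2 hk₂
    rw [b₁] at c₁
    rw [b₂] at c₂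
    refine hW'.free.eq_of_inc h₁₂ c₁ c₂ ?_ ?_
    · rw [hW'.sub.inc _ (hDE'.1 hD₁) _ hlE', hE']; simp
    · rw [hW'.sub.inc _ (hDE'.1 hD₂) _ hlE', hE']; simp
  have hn : ¬ G.inc w₃ k := by
    rw [← hW.emb.inc, a₃, hek, hW.sub.inc _ (hDE.1 hD₃) _ hlE, hE]
    rintro (h | ⟨-, h | h⟩)
    · exact hl (D.supp h).2
    · exact h₁₃ h.symm
    · exact h₂₃ h.symm
  refine hn ?_
  rw [← hW'.emb.inc, b₃, hek', hW'.sub.inc _ (hDE'.1 hD₃) _ hlE', hE']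
  simp

/-- The freely added intersection point is tracked because the extension still has a witness. -/
lemma exists_tracked_meet (hG : G.Complete 2 2) {D : Cond 2 2}
    (hno : ∀ E, D ≤ E → ∃ Q e, Wit G a a' E Q e) {g h : ℕ} (hg : Tracked G a a' D g)
    (hh : Tracked G a a' D h) (hgl : ¬ D.geo.pt g) (hhl : ¬ D.geo.pt h) (hgh : g ≠ h)
    (hm : ∀ p, D.geo.inc p g → ¬ D.geo.inc p h) :
    ∃ E, D ≤ E ∧ ∃ x ∉ D.dom, Tracked G a a' E x ∧ E.geo.pt x ∧
      ∀ y z, E.geo.inc y z ↔ D.geo.inc y z ∨ (y = x ∧ (z = g ∨ z = h)) := by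
  obtain ⟨E, hE, x, hx, hxE, hxp, hinc⟩ := D.exists_addPoint_two hg.1 hh.1 hgl hhl hm
  exact ⟨E, hE, x, hx, Tracked.meet hG (hno E hE) (hg.mono hE) (hh.mono hE) hgh
    ((hinc _ _).2 (by simp)) ((hinc _ _).2 (by simp)), hxp, hinc⟩

lemma exists_tracked_join (hG : G.Complete 2 2) {D : Cond 2 2}
    (hno : ∀ E, D ≤ E → ∃ Q e, Wit G a a' E Q e) {p q : ℕ} (hp : Tracked G a a' D p)
    (hq : Tracked G a a' D q) (hpp : D.geo.pt p) (hqp : D.geo.pt q) (hpq : p ≠ q)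
    (hj : ∀ l, D.geo.inc p l → ¬ D.geo.inc q l) :
    ∃ E, D ≤ E ∧ ∃ x ∉ D.dom, Tracked G a a' E x ∧ ¬ E.geo.pt x ∧
      ∀ y z, E.geo.inc y z ↔ D.geo.inc y z ∨ (z = x ∧ (y = p ∨ y = q)) := by
  obtain ⟨E, hE, x, hx, hxE, hxp, hinc⟩ := D.exists_addLine_two (S := {p, q})
    (by intro y; simp; rintro (rfl | rfl); exacts [hp.1, hq.1]) (by simp [hpp, hqp]) (by
      simp only [Finset.mem_insert, Finset.mem_singleton]
      grind)
  simp only [Finset.mem_insert, Finset.mem_singleton] at hinc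
  exact ⟨E, hE, x, hx, Tracked.join hG (hno E hE) (hp.mono hE) (hq.mono hE) hpq
    ((hinc _ _).2 (by simp)) ((hinc _ _).2 (by simp)), hxp, hinc⟩

/-- If two tracked lines do not meet, and there is a tracked triangle outside of them, then some
extension is not compatible with `G`. -/
lemma exists_no_wit_of_not_meet (hG : G.Complete 2 2) {D : Cond 2 2} {g h x₁ x₂ x₃ k₁ k₂ k₃ : ℕ}
    (hgt : Tracked G a a' D g) (hht : Tracked G a a' D h) (hg : ¬ D.geo.pt g) (hh : ¬ D.geo.pt h)
    (hgh : g ≠ h) (hm : ∀ p, D.geo.inc p g → ¬ D.geo.inc p h)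
    (hx₁ : Tracked G a a' D x₁) (hx₂ : Tracked G a a' D x₂) (hx₃ : Tracked G a a' D x₃)
    (hk₁ : Tracked G a a' D k₁) (hk₂ : Tracked G a a' D k₂) (hk₃ : Tracked G a a' D k₃)
    (h₁₁ : ¬ D.geo.inc x₁ k₁) (h₁₂ : D.geo.inc x₁ k₂) (h₁₃ : D.geo.inc x₁ k₃)
    (h₂₁ : D.geo.inc x₂ k₁) (h₂₂ : ¬ D.geo.inc x₂ k₂) (h₂₃ : D.geo.inc x₂ k₃)
    (h₃₁ : D.geo.inc x₃ k₁) (h₃₂ : D.geo.inc x₃ k₂) (h₃₃ : ¬ D.geo.inc x₃ k₃)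
    (hg₁ : ¬ D.geo.inc x₁ g) (hg₂ : ¬ D.geo.inc x₂ g) (hg₃ : ¬ D.geo.inc x₃ g)
    (hh₁ : ¬ D.geo.inc x₁ h) (hh₂ : ¬ D.geo.inc x₂ h) (hh₃ : ¬ D.geo.inc x₃ h) :
    ∃ E, D ≤ E ∧ ¬ ∃ Q e, Wit G a a' E Q e := by
  by_contra! hno
  have hno' : ∀ E, D ≤ E → ∃ Q e, Wit G a a' E Q e := hno
  have supp : ∀ {y z}, D.geo.inc y z → y ∈ D.dom ∧ z ∈ D.dom := D.supp
  have hx₁p := D.geo.pt_of_inc h₁₂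
  have hx₂p := D.geo.pt_of_inc h₂₃
  have hx₃p := D.geo.pt_of_inc h₃₁
  have hk₁l := D.geo.not_pt_of_inc h₂₁
  have hk₂l := D.geo.not_pt_of_inc h₁₂
  have hk₃l := D.geo.not_pt_of_inc h₁₃
  have hx₁₂ : x₁ ≠ x₂ := by rintro rfl; exact h₁₁ h₂₁
  have hx₁₃ : x₁ ≠ x₃ := by rintro rfl; exact h₁₁ h₃₁
  have hx₂₃ : x₂ ≠ x₃ := by rintro rfl; exact h₂₂ h₃₂
  have hk₁₂ : k₁ ≠ k₂ := by rintro rfl; exact h₁₁ h₁₂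
  have hk₁₃ : k₁ ≠ k₃ := by rintro rfl; exact h₁₁ h₁₃
  have hk₂₃ : k₂ ≠ k₃ := by rintro rfl; exact h₂₂ h₂₃
  -- Each side of the triangle passes through `x₁` or `x₂`, which lie off `g` and `h`. So the new
  -- point `r`, lying only on `g` and `h`, is on no side and is joined to no vertex.
  have hgk : ∀ {y}, (D.geo.inc x₁ y ∨ D.geo.inc x₂ y) → y ≠ g ∧ y ≠ h := by
    rintro y (hy | hy)
    · exact ⟨by rintro rfl; exact hg₁ hy, by rintro rfl; exact hh₁ hy⟩
    · exact ⟨by rintro rfl; exact hg₂ hy, by rintro rfl; exact hh₂ hy⟩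
  have hgk₁ := hgk (Or.inr h₂₁)
  have hgk₂ := hgk (Or.inl h₁₂)
  have hgk₃ := hgk (Or.inl h₁₃)
  clear hgk
  -- The intersection point `r` of `g` and `h`.
  obtain ⟨D₁, le₁, r, hrD, hrt, hrp, inc₁⟩ := exists_tracked_meet hG hno' hgt hht hg hh hgh hm
  have hx : ∀ {y}, y ∈ D.dom → y ≠ r := fun hy h => hrD (h ▸ hy)
  have join : ∀ {E : Cond 2 2} {x : ℕ}, D₁ ≤ E → Tracked G a a' D x → D.geo.pt x →
      (∀ l, E.geo.inc r l → ¬ E.geo.inc x l) →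
      ∃ E', E ≤ E' ∧ ∃ f ∉ E.dom, Tracked G a a' E' f ∧ ¬ E'.geo.pt f ∧
        ∀ y z, E'.geo.inc y z ↔ E.geo.inc y z ∨ (z = f ∧ (y = r ∨ y = x)) := by
    intro E x hE hxt hxp hj
    exact exists_tracked_join hG (fun E' hE' => hno' E' (le₁.trans (hE.trans hE')))
      (hrt.mono hE) (hxt.mono (le₁.trans hE)) ((hE.2.pt r hrt.1).2 hrp)
      (((le₁.trans hE).2.pt x hxt.1).2 hxp) (hx hxt.1).symm hj
  have hgD := hgt.1
  have hhD := hht.1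
  have hx₁D := hx₁.1
  have hx₂D := hx₂.1
  have hx₃D := hx₃.1
  have hk₁D := hk₁.1
  have hk₂D := hk₂.1
  have hk₃D := hk₃.1
  have hr₁ := hx hx₁D
  have hr₂ := hx hx₂D
  have hr₃ := hx hx₃D
  have hrl : ∀ l, ¬ D.geo.inc r l := fun l hl => hrD (supp hl).1
  -- The lines `f₁`, `f₂`, `f₃` joining `r` to the three points.
  obtain ⟨D₂, le₂, f₁, hf₁D, hf₁t, hf₁l, inc₂⟩ := join le_rfl hx₁ hx₁p (by
    clear join hno hno'
    grind)
  replace hf₁D : f₁ ∉ D.dom := fun h => hf₁D (le₁.1 h)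
  have hf₁ : ∀ y, ¬ D.geo.inc y f₁ := fun y hy => hf₁D (supp hy).2
  obtain ⟨D₃, le₃, f₂, hf₂D, hf₂t, hf₂l, inc₃⟩ := join le₂ hx₂ hx₂p (by
    clear join hno hno'
    intro l
    simp only [inc₂, inc₁]
    grind)
  have hf₂₁ : f₂ ≠ f₁ := by rintro rfl; exact hf₂D hf₁t.1
  replace hf₂D : f₂ ∉ D.dom := fun h => hf₂D (le₂.1 (le₁.1 h))
  have hf₂ : ∀ y, ¬ D.geo.inc y f₂ := fun y hy => hf₂D (supp hy).2
  obtain ⟨D₄, le₄, f₃, hf₃D, hf₃t, hf₃l, inc₄⟩ := join (le₂.trans le₃) hx₃ hx₃p (by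
    clear join hno hno'
    intro l
    simp only [inc₃, inc₂, inc₁]
    grind)
  have hf₃₁ : f₃ ≠ f₁ := by rintro rfl; exact hf₃D (le₃.1 hf₁t.1)
  have hf₃₂ : f₃ ≠ f₂ := by rintro rfl; exact hf₃D hf₂t.1
  replace hf₃D : f₃ ∉ D.dom := fun h => hf₃D (le₃.1 (le₂.1 (le₁.1 h)))
  have hf₃ : ∀ y, ¬ D.geo.inc y f₃ := fun y hy => hf₃D (supp hy).2
  simp only [inc₃, inc₂, inc₁] at inc₄
  have leD₄ : D ≤ D₄ := le₁.trans (le₂.trans (le₃.trans le₄))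
  clear inc₁ inc₂ inc₃ join
  replace hf₁l := mt ((le₃.trans le₄).2.pt f₁ hf₁t.1).1 hf₁l
  replace hf₂l := mt (le₄.2.pt f₂ hf₂t.1).1 hf₂l
  replace hf₁t := hf₁t.mono (le₃.trans le₄)
  replace hf₂t := hf₂t.mono le₄
  have hrf : ∀ {k}, k ∈ D.dom → k ≠ f₁ ∧ k ≠ f₂ ∧ k ≠ f₃ := fun hk =>
    ⟨fun h => hf₁D (h ▸ hk), fun h => hf₂D (h ▸ hk), fun h => hf₃D (h ▸ hk)⟩
  have meet : ∀ {E : Cond 2 2} {f k : ℕ}, D₄ ≤ E → Tracked G a a' D₄ f → ¬ D₄.geo.pt f →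
      Tracked G a a' D k → ¬ D.geo.pt k → f ≠ k → (∀ p, E.geo.inc p f → ¬ E.geo.inc p k) →
      ∃ E', E ≤ E' ∧ ∃ s ∉ E.dom, Tracked G a a' E' s ∧ E'.geo.pt s ∧
        ∀ y z, E'.geo.inc y z ↔ E.geo.inc y z ∨ (y = s ∧ (z = f ∨ z = k)) := by
    intro E f k hE hf hfl hk hkl hfk hm
    exact exists_tracked_meet hG (fun E' hE' => hno' E' (leD₄.trans (hE.trans hE')))
      (hf.mono hE) (hk.mono (leD₄.trans hE)) (mt (hE.2.pt f hf.1).1 hfl)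
      (mt ((leD₄.trans hE).2.pt k hk.1).1 hkl) hfk hm
  have hfk₁ := hrf hk₁D
  have hfk₂ := hrf hk₂D
  have hfk₃ := hrf hk₃D
  -- The intersection points `s₁`, `s₂`, `s₃` of these lines with the sides of the triangle.
  obtain ⟨D₅, le₅, s₁, hs₁D, hs₁t, hs₁p, inc₅⟩ := meet le_rfl hf₁t hf₁l hk₁ hk₁l hfk₁.1.symm (by
    clear meet hno hno'
    intro p
    simp only [inc₄]
    grind)
  have hs₁ : ∀ l, ¬ D₄.geo.inc s₁ l := fun l hl => hs₁D (D₄.supp hl).1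
  obtain ⟨D₆, le₆, s₂, hs₂D, hs₂t, hs₂p, inc₆⟩ := meet le₅ hf₂t hf₂l hk₂ hk₂l hfk₂.2.1.symm (by
    clear meet hno hno'
    intro p
    simp only [inc₅, inc₄]
    grind)
  have hs₂₁ : s₂ ≠ s₁ := by rintro rfl; exact hs₂D hs₁t.1
  have hs₂ : ∀ l, ¬ D₄.geo.inc s₂ l := fun l hl => hs₂D (le₅.1 (D₄.supp hl).1)
  obtain ⟨D₇, le₇, s₃, hs₃D, hs₃t, hs₃p, inc₇⟩ := meet (le₅.trans le₆) hf₃t hf₃l hk₃ hk₃l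
    hfk₃.2.2.symm (by
    clear meet hno hno'
    intro p
    simp only [inc₆, inc₅, inc₄]
    grind)
  have hs₃₁ : s₃ ≠ s₁ := by rintro rfl; exact hs₃D (le₆.1 hs₁t.1)
  have hs₃₂ : s₃ ≠ s₂ := by rintro rfl; exact hs₃D hs₂t.1
  have hs₃ : ∀ l, ¬ D₄.geo.inc s₃ l := fun l hl => hs₃D (le₆.1 (le₅.1 (D₄.supp hl).1))
  simp only [inc₆, inc₅] at inc₇
  -- Each `sᵢ` lies on `fᵢ` and `kᵢ` only; these six lines are distinct, so no two of the `sᵢ` are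
  -- joined.
  have hn₁ : ∀ l, D₇.geo.inc s₁ l ↔ l = f₁ ∨ l = k₁ := fun l => by
    simp [inc₇, hs₁, hs₂₁.symm, hs₃₁.symm]
  have hn₂ : ∀ l, D₇.geo.inc s₂ l ↔ l = f₂ ∨ l = k₂ := fun l => by
    simp [inc₇, hs₂, hs₂₁, hs₃₂.symm]
  have hn₃ : ∀ l, D₇.geo.inc s₃ l ↔ l = f₃ ∨ l = k₃ := fun l => by
    simp [inc₇, hs₃, hs₃₁, hs₃₂]
  have leD₇ : D ≤ D₇ := leD₄.trans (le₅.trans (le₆.trans le₇))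
  obtain ⟨E, hE, hE'⟩ := exists_no_wit_of_not_joined hG (hs₁t.mono (le₆.trans le₇))
    (hs₂t.mono le₇) hs₃t (((le₆.trans le₇).2.pt s₁ hs₁t.1).2 hs₁p)
    ((le₇.2.pt s₂ hs₂t.1).2 hs₂p) hs₃p hs₂₁.symm hs₃₁.symm hs₃₂.symm
    (by intro l; rw [hn₁, hn₂]; rintro (rfl | rfl) (h | h) <;> grind)
    (by intro l; rw [hn₁, hn₃]; rintro (rfl | rfl) (h | h) <;> grind)
    (by intro l; rw [hn₂, hn₃]; rintro (rfl | rfl) (h | h) <;> grind)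
  exact hE' (hno' E (leD₇.trans hE))

end Tracked

end Cond

/-! ### Part (b): the tracked elements form a projective plane -/

/-- The seven points `0, …, 6` in general position, with a line for each unordered pair. -/
def heptagon : Geo (Fin 7 ⊕ Sym2 (Fin 7)) where
  pt x := x.isLeft
  inc x y := ∃ i s, x = Sum.inl i ∧ y = Sum.inr s ∧ i ∈ s
  pt_of_inc := by
    rintro _ _ ⟨i, s, rfl, rfl, -⟩
    rfl
  not_pt_of_inc := by
    rintro _ _ ⟨i, s, rfl, rfl, -⟩
    simp

lemma heptagon_free : heptagon.Free 2 2 := by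
  intro P L hP hL H
  obtain ⟨p, q, hpq, rfl⟩ := Finset.card_eq_two.1 hP
  obtain ⟨g, h, hgh, rfl⟩ := Finset.card_eq_two.1 hL
  obtain ⟨i, s, rfl, rfl, his⟩ := H p (by simp) g (by simp)
  obtain ⟨i', t, hi', rfl, hit⟩ := H (Sum.inl i) (by simp) h (by simp)
  obtain ⟨j, s', rfl, hs', hjs⟩ := H q (by simp) (Sum.inr s) (by simp)
  obtain ⟨j', t', hj', ht', hjt⟩ := H (Sum.inl j) (by simp) (Sum.inr t) (by simp)
  cases hi'; cases hj'; cases hs'; cases ht'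
  have hij : i ≠ j := fun h => hpq (congrArg _ h)
  exact hgh (congrArg _ (((Sym2.mem_and_mem_iff hij).1 ⟨his, hjs⟩).trans
    ((Sym2.mem_and_mem_iff hij).1 ⟨hit, hjt⟩).symm))

lemma heptagon_inc {i j l : Fin 7} :
    heptagon.inc (Sum.inl l) (Sum.inr s(i, j)) ↔ l = i ∨ l = j := by
  simp [heptagon]

namespace Cond

section Tracked

variable {M A : Type*} {G : Geo M} {a : A ⊕ (Fin 7 ⊕ Sym2 (Fin 7)) → M}
  {a' : A ⊕ (Fin 7 ⊕ Sym2 (Fin 7)) → ℕ}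

/-- The reason for seven points: two lines cover at most four of them, and three must remain as the
vertices of a triangle. -/
lemma exists_three_of_card_le_four (p : Fin 7 → Prop) [DecidablePred p]
    (h : (Finset.univ.filter p).card ≤ 4) :
    ∃ i j k : Fin 7, ¬ p i ∧ ¬ p j ∧ ¬ p k ∧ i ≠ j ∧ i ≠ k ∧ j ≠ k := by
  have h1 := Finset.card_filter_add_card_filter_not (s := (Finset.univ : Finset (Fin 7))) p
  rw [Finset.card_univ, Fintype.card_fin] at h1
  obtain ⟨i, j, k, hi, hj, hk, h⟩ := Finset.two_lt_card_iff.1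
    (show 2 < (Finset.univ.filter fun i => ¬ p i).card by omega)
  simp only [Finset.mem_filter, Finset.mem_univ, true_and] at hi hj hk
  exact ⟨i, j, k, hi, hj, hk, h⟩

/-- If no finite projective plane contains a copy of `A`, then the conditions which exclude an
embedding of `G` sending `a` to `a'` are cofinal. -/
lemma exists_no_wit (hG : G.Complete 2 2) (hconf : Geo.IsEmb heptagon G (a ∘ Sum.inr))
    (hfin : ∀ (S : Finset ℕ) (Z : Geo S), Z.Free 2 2 → Z.Complete 2 2 → ∀ f : A → S,
      ¬ Geo.IsEmb (G.comap (a ∘ Sum.inl)) Z f) (hinj : Function.Injective (a ∘ Sum.inl))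
    {C : Cond 2 2} (hC : ∀ i, a' i ∈ C.dom) : ∃ D, C ≤ D ∧ ¬ ∃ Q e, Wit G a a' D Q e := by
  classical
  by_contra! hno
  have hno' : ∀ E, C ≤ E → ∃ Q e, Wit G a a' E Q e := hno
  obtain ⟨Q, e, hW⟩ := hno C le_rfl
  have ht : ∀ i, Tracked G a a' C (a' i) := fun i => ⟨hC i, a i, fun Q e hW => hW.map i⟩
  have hCinc : ∀ i j, C.geo.inc (a' i) (a' j) ↔ G.inc (a i) (a j) := fun i j => by
    rw [← hW.sub.inc _ (hC i) _ (hC j), ← hW.map, ← hW.map, hW.emb.inc]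
  have hCpt : ∀ i, C.geo.pt (a' i) ↔ G.pt (a i) := fun i => by
    rw [← hW.sub.pt _ (hC i), ← hW.map, hW.emb.pt]
  have hCinj : ∀ i j, a' i = a' j ↔ a i = a j := fun i j => by
    rw [← hW.map, ← hW.map, hW.emb.inj.eq_iff]
  let X : Fin 7 → ℕ := fun i => a' (Sum.inr (Sum.inl i))
  let K : Fin 7 → Fin 7 → ℕ := fun i j => a' (Sum.inr (Sum.inr s(i, j)))
  have hXK : ∀ i j l, C.geo.inc (X l) (K i j) ↔ l = i ∨ l = j := fun i j l => by
    rw [hCinc, ← heptagon_inc]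
    exact hconf.inc _ _
  have hXinj : Function.Injective X := fun i j hij =>
    Sum.inl_injective (hconf.inj ((hCinj _ _).1 hij))
  -- A line through two of the seven points is their joining line `K i j`, which contains no third
  -- one.
  have hline : ∀ g, (Finset.univ.filter fun i => C.geo.inc (X i) g).card ≤ 2 := by
    intro g
    by_contra! hlt
    obtain ⟨i, j, k, hi, hj, hk, hij, hik, hjk⟩ := Finset.two_lt_card_iff.1 hlt
    simp only [Finset.mem_filter, Finset.mem_univ, true_and] at hi hj hk
    obtain rfl := C.free.eq_of_inc (hXinj.ne hij) hi hj ((hXK i j i).2 (by simp))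
      ((hXK i j j).2 (by simp))
    rcases (hXK _ _ _).1 hk with h | h
    · exact hik h.symm
    · exact hjk h.symm
  -- There are no two tracked lines without a common point in an extension whose incidences
  -- with the seven points are those of `C`.
  have hmeet : ∀ D, C ≤ D → ∀ g h, Tracked G a a' D g → Tracked G a a' D h → ¬ D.geo.pt g →
      ¬ D.geo.pt h → g ≠ h → (∃ i j k : Fin 7, (¬ D.geo.inc (X i) g ∧ ¬ D.geo.inc (X i) h) ∧
        (¬ D.geo.inc (X j) g ∧ ¬ D.geo.inc (X j) h) ∧ (¬ D.geo.inc (X k) g ∧ ¬ D.geo.inc (X k) h) ∧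
        i ≠ j ∧ i ≠ k ∧ j ≠ k) → ∃ p, D.geo.inc p g ∧ D.geo.inc p h := by
    rintro D hD g h hg hh hgl hhl hgh ⟨i, j, k, hi, hj, hk, hij, hik, hjk⟩
    by_contra! hm
    have hinc : ∀ i j l, D.geo.inc (X l) (K i j) ↔ l = i ∨ l = j := fun i j l => by
      rw [hD.2.inc _ (hC _) _ (hC _), hXK]
    have hX : ∀ i, Tracked G a a' D (X i) := fun i => (ht _).mono hD
    have hK : ∀ i j, Tracked G a a' D (K i j) := fun i j => (ht _).mono hD
    obtain ⟨E, hE, hE'⟩ := exists_no_wit_of_not_meet hG hg hh hgl hhl hgh hm (hX i) (hX j) (hX k)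
      (hK j k) (hK i k) (hK i j) (by simp [hinc, hij, hik]) (by simp [hinc])
      (by simp [hinc]) (by simp [hinc]) (by simp [hinc, hij.symm, hjk]) (by simp [hinc])
      (by simp [hinc]) (by simp [hinc]) (by simp [hinc, hik.symm, hjk.symm]) hi.1 hj.1 hk.1 hi.2 hj.2 hk.2
    exact hE' (hno' E (hD.trans hE))
  have hmeetC : ∀ g h, Tracked G a a' C g → Tracked G a a' C h → ¬ C.geo.pt g →
      ¬ C.geo.pt h → g ≠ h → ∃ p, C.geo.inc p g ∧ C.geo.inc p h := by
    intro g h hg hh hgl hhl hgh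
    refine hmeet C le_rfl g h hg hh hgl hhl hgh ?_
    obtain ⟨i, j, k, hi, hj, hk, hijk⟩ := exists_three_of_card_le_four
      (fun i => C.geo.inc (X i) g ∨ C.geo.inc (X i) h) (by
        rw [Finset.filter_or]
        exact (Finset.card_union_le _ _).trans (add_le_add (hline g) (hline h)))
    exact ⟨i, j, k, not_or.1 hi, not_or.1 hj, not_or.1 hk, hijk⟩
  have hjoinC : ∀ p q, Tracked G a a' C p → Tracked G a a' C q → C.geo.pt p → C.geo.pt q →
      p ≠ q → ∃ l, C.geo.inc p l ∧ C.geo.inc q l := by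
    intro p q hp hq hpp hqp hpq
    by_contra! hj
    -- Unjoined points are reduced to lines that do not meet: the new line `f` contains only `p` and
    -- `q`, so it does not meet a line `K u v` that avoids both.
    obtain ⟨D, hD, f, hfC, hft, hfl, hinc⟩ := exists_tracked_join hG hno' hp hq hpp hqp hpq hj
    have hpq2 : (Finset.univ.filter fun i => X i = p ∨ X i = q).card ≤ 2 := by
      have h1 : ∀ z, (Finset.univ.filter fun i => X i = z).card ≤ 1 := fun z =>
        Finset.card_le_one.2 fun i hi j hj => hXinj
          ((Finset.mem_filter.1 hi).2.trans (Finset.mem_filter.1 hj).2.symm)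
      rw [Finset.filter_or]
      exact (Finset.card_union_le _ _).trans (add_le_add (h1 p) (h1 q))
    obtain ⟨i, j, k, hi, hj, hk, hij, hik, hjk⟩ := exists_three_of_card_le_four _
      (hpq2.trans (by norm_num))
    have hz : ∀ z u v w, X u ≠ z → w ≠ u → w ≠ v → C.geo.inc z (K u v) → ¬ C.geo.inc z (K u w) := by
      intro z u v w hzu hwu hwv h1 h2
      have h3 := C.free.eq_of_inc hzu ((hXK u v u).2 (by simp)) h1 ((hXK u w u).2 (by simp)) h2
      have h4 : C.geo.inc (X w) (K u w) := (hXK u w w).2 (by simp)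
      rw [← h3, hXK] at h4
      exact h4.elim hwu hwv
    have hswap : ∀ u v, K u v = K v u := fun u v => by simp only [K, Sym2.eq_swap]
    -- A point other than the vertices lies on at most one side of the triangle `i j k`, so `p` and
    -- `q` together spoil at most two of its three sides.
    obtain ⟨u, v, hpt, hqt⟩ : ∃ u v, ¬ C.geo.inc p (K u v) ∧ ¬ C.geo.inc q (K u v) := by
      have key : ∀ z, X i ≠ z → X j ≠ z → X k ≠ z →
          (C.geo.inc z (K i j) → ¬ C.geo.inc z (K i k)) ∧
          (C.geo.inc z (K i j) → ¬ C.geo.inc z (K j k)) ∧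
          (C.geo.inc z (K i k) → ¬ C.geo.inc z (K j k)) := by
        intro z hzi hzj hzk
        refine ⟨hz z i j k hzi hik.symm hjk.symm, ?_, ?_⟩
        · rw [hswap i j]
          exact hz z j i k hzj hjk.symm hik.symm
        · rw [hswap i k, hswap j k]
          exact hz z k i j hzk hjk hij.symm
      have kp := key p (fun h => hi (Or.inl h)) (fun h => hj (Or.inl h)) (fun h => hk (Or.inl h))
      have kq := key q (fun h => hi (Or.inr h)) (fun h => hj (Or.inr h)) (fun h => hk (Or.inr h))
      by_contra! H
      by_cases h : C.geo.inc p (K i j)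
      · exact kq.2.2 (H _ _ (kp.1 h)) (H _ _ (kp.2.1 h))
      · have h' := H _ _ h
        exact kp.2.2 (by_contra fun h1 => kq.1 h' (H _ _ h1))
          (by_contra fun h1 => kq.2.1 h' (H _ _ h1))
    have htC : K u v ∈ C.dom := hC _
    have hne : f ≠ K u v := fun h => hfC (h ▸ htC)
    have hf : ∀ y, D.geo.inc y f ↔ y = p ∨ y = q := fun y => by
      rw [hinc]
      exact ⟨fun h => (h.resolve_left fun h => hfC (C.supp h).2).2, fun h => Or.inr ⟨rfl, h⟩⟩
    have htD : ∀ y, D.geo.inc y (K u v) ↔ C.geo.inc y (K u v) := fun y => by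
      rw [hinc]
      exact or_iff_left fun h => hne h.1.symm
    obtain ⟨y, hy1, hy2⟩ := hmeet D hD f (K u v) hft ((ht _).mono hD) hfl
      (D.geo.not_pt_of_inc ((htD (X u)).2 ((hXK u v u).2 (by simp)))) hne <| by
      obtain ⟨i, j, k, hi, hj, hk, hijk⟩ := exists_three_of_card_le_four
        (fun i => (X i = p ∨ X i = q) ∨ C.geo.inc (X i) (K u v)) (by
          rw [Finset.filter_or]
          exact (Finset.card_union_le _ _).trans (add_le_add hpq2 (hline _)))
      simp only [hf, htD]
      exact ⟨i, j, k, not_or.1 hi, not_or.1 hj, not_or.1 hk, hijk⟩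
    rw [htD] at hy2
    rcases (hf y).1 hy1 with rfl | rfl
    · exact hpt hy2
    · exact hqt hy2
  -- The forbidden finite projective plane.
  let S := C.dom.filter (Tracked G a a' C)
  have hS : ∀ x : S, Tracked G a a' C x := fun x => (Finset.mem_filter.1 x.2).2
  have hSm : ∀ x, Tracked G a a' C x → x ∈ S := fun x hx => Finset.mem_filter.2 ⟨hx.1, hx⟩
  refine hfin S (C.geo.comap Subtype.val) ((Geo.isEmb_comap Subtype.val_injective _).free C.free)
    (Geo.complete_two ?_ ?_) (fun i => ⟨a' (Sum.inl i), hSm _ (ht _)⟩) ⟨?_, ?_, ?_⟩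
  · intro p q hpq hp hq
    have hne : (p : ℕ) ≠ q := fun h => hpq (Subtype.ext h)
    obtain ⟨l, h1, h2⟩ := hjoinC p q (hS p) (hS q) hp hq hne
    exact ⟨⟨l, hSm l (Tracked.join hG ⟨Q, e, hW⟩ (hS p) (hS q) hne h1 h2)⟩, h1, h2⟩
  · intro g h hgh hg hh
    have hne : (g : ℕ) ≠ h := fun H => hgh (Subtype.ext H)
    obtain ⟨l, h1, h2⟩ := hmeetC g h (hS g) (hS h) hg hh hne
    exact ⟨⟨l, hSm l (Tracked.meet hG ⟨Q, e, hW⟩ (hS g) (hS h) hne h1 h2)⟩, h1, h2⟩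
  · intro i j hij
    exact hinj ((hCinj _ _).1 (congrArg Subtype.val hij))
  · exact fun i => hCpt _
  · exact fun i j => hCinc _ _

end Tracked

end Cond

/-! ### Part (b): a model that omits the prime model -/

/-- If `T 2 2` has a prime model, then every finite partial plane embeds in a finite projective
plane. -/
theorem exists_finite_completion (h : HasPrimeModel.{u} (T 2 2)) (A : Type) [Finite A]
    [lang.Structure A] (hA : A ⊨ Tp 2 2) :
    ∃ (B : Type) (_ : Finite B) (_ : lang.Structure B), B ⊨ Tc 2 2 ∧ Nonempty (A ↪[lang] B) := by
  classical
  by_contra! hno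
  obtain ⟨M, hM⟩ := h
  have two : 1 ≤ 2 := one_le_two
  obtain ⟨hAG, hAF⟩ := (model_Tp two two).1 hA
  obtain ⟨hMG, hMF, hMC⟩ := (model_Tc two two).1 (model_Tc_of_model_T M.is_model)
  obtain ⟨b, hb⟩ := exists_isEmb_of_finite two two M.is_model hAF
  obtain ⟨c, hc⟩ := exists_isEmb_of_finite two two M.is_model heptagon_free
  let a : A ⊕ (Fin 7 ⊕ Sym2 (Fin 7)) → M := Sum.elim b c
  have hfin : ∀ (S : Finset ℕ) (Z : Geo S), Z.Free 2 2 → Z.Complete 2 2 → ∀ f : A → S,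
      ¬ Geo.IsEmb ((geo M).comap (a ∘ Sum.inl)) Z f := by
    intro S Z hZF hZC f hf
    let _ := Z.toStructure
    have hZ : geo S = Z := Z.geo_toStructure
    refine (hno S inferInstance inferInstance ((model_Tc two two).2
      ⟨Z.isGeo, by rwa [hZ], by rwa [hZ]⟩)).elim ?_
    have hf' : Geo.IsEmb (geo A) (geo S) f := by
      rw [hZ]
      exact ⟨hf.inj, fun x => (hf.pt x).trans (hb.pt x),
        fun x y => (hf.inc x y).trans (hb.inc x y)⟩
    exact hf'.toEmbedding hAG Z.isGeo
  -- The tuple `a` is finite, so there are only countably many candidates `a'` for its image; each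
  -- is excluded by one cofinal set.
  obtain ⟨N, hNT, hN⟩ := Cond.exists_generic two two
    (fun a' : A ⊕ (Fin 7 ⊕ Sym2 (Fin 7)) → ℕ =>
      {C : Cond 2 2 | ¬ ∃ Q e, Cond.Wit (geo M) a a' C Q e}) <| by
    intro a' C
    have := Fintype.ofFinite (A ⊕ (Fin 7 ⊕ Sym2 (Fin 7)))
    obtain ⟨D, hD, hW⟩ := Cond.exists_no_wit (a := a) (a' := a') hMC hc hfin hb.inj
      (C := C.union (Finset.univ.image a'))
      fun i => C.subset_union _ (Finset.mem_image_of_mem _ (Finset.mem_univ i))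
    exact ⟨D, hW, (C.le_union _).trans hD⟩
  let _ := N.toStructure
  have hg : geo ℕ = N := N.geo_toStructure
  have hNT' : ℕ ⊨ T 2 2 := hNT
  have hNF : N.Free 2 2 := by
    have := ((model_Tc two two).1 (model_Tc_of_model_T hNT')).2.1
    rwa [hg] at this
  let P := Theory.ModelType.ulift.{0, 0, 0, u} (Theory.ModelType.of (T 2 2) ℕ)
  let e : ℕ ≃[lang] P := Equiv.ulift.{u, 0}.symm.inducedStructureEquiv
  obtain ⟨j⟩ := hM P
  have hj := isEmb_embedding (e.symm.toEmbedding.comp j.toEmbedding)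
  rw [hg] at hj
  -- The generic structure `N` with the embedding of `M` would itself be a witness for the condition
  -- that excludes this image of `a`. Elementarity of `j` plays no role.
  obtain ⟨C, hC, hCN⟩ := hN (e.symm.toEmbedding.comp j.toEmbedding ∘ a)
  exact hC ⟨N, _, hCN, hNF, hj, fun _ => rfl⟩

end Incidence

theorem theorem3p7 :
    (∀ m n : ℕ, 1 ≤ m → 1 ≤ n →
      (∀ (A : Type) [Finite A] [Incidence.lang.Structure A], A ⊨ Incidence.Tp m n →
        ∃ (B : Type) (_ : Finite B) (_ : Incidence.lang.Structure B),
          B ⊨ Incidence.Tc m n ∧ Nonempty (A ↪[Incidence.lang] B)) →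
      Incidence.HasPrimeModel.{u} (Incidence.T m n)) ∧
    (Incidence.HasPrimeModel.{u} (Incidence.T 2 2) ↔
      ∀ (A : Type) [Finite A] [Incidence.lang.Structure A], A ⊨ Incidence.Tp 2 2 →
        ∃ (B : Type) (_ : Finite B) (_ : Incidence.lang.Structure B),
          B ⊨ Incidence.Tc 2 2 ∧ Nonempty (A ↪[Incidence.lang] B)) :=
  ⟨fun _ _ hm hn H => Incidence.hasPrimeModel_T hm hn H,
    fun h A _ _ hA => Incidence.exists_finite_completion h A hA,
    fun H => Incidence.hasPrimeModel_T one_le_two one_le_two H⟩
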